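/- Let $\Omega$ be a finite set of objects and $F$ a finite set of flaws, a flaw being a non-empty subset $f\subseteq\Omega$; put $F_\sigma=\{f\in F : \sigma\in f\}$ and call $\sigma$ flawless if $F_\sigma=\varnothing$. For each $\sigma\in\Omega$ and $f\in F_\sigma$ let $\rho(\cdot\,|\,f,\sigma)$ be a probability distribution on $\Omega$ with support $A(f,\sigma)$, and write $\sigma\xrightarrow{f}\sigma'$ if $f\in F_\sigma$ and $\sigma'\in A(f,\sigma)$. Let $\omega$ be a probability distribution on $\Omega$ with $\omega(\sigma)>0$ for all $\sigma$. Let $\sim$ be a symmetric relation on $F$ (possibly with $f\sim f$), $\Gamma(f)=\{g : f\sim g\}$, $\Gamma^+(f)=\Gamma(f)\cup\{f\}$, $\Gamma^+(I)=\bigcup_{f\in I}\Gamma^+(f)$, and assume that $F_{\sigma'}\subseteq(F_\sigma\setminus\{f\})\cup\Gamma(f)$ whenever $\sigma\xrightarrow{f}\sigma'$. A set $S\subseteq F$ is independent if $f\not\sim g$ for all distinct $f,g\in S$; $\mathrm{Ind}(S)$ is the set of independent subsets of $S$. Assume that $(\rho,\sim)$ is strongly commutative: there is an injective mapping that sends every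 walk $\sigma_1\xrightarrow{f}\sigma_2\xrightarrow{g}\sigma_3$ with $f\not\sim g$ to a walk $\sigma_1\xrightarrow{g}\sigma_2'\xrightarrow{f}\sigma_3$ such that $\rho(\sigma_2|f,\sigma_1)\rho(\sigma_3|g,\sigma_2)=\rho(\sigma_2'|g,\sigma_1)\rho(\sigma_3|f,\sigma_2')$. Let $\theta\in(0,1)$ and $\lambda\in\mathbb R^F$ be such that $$\lambda_f\ \ge\ \sum_{\sigma\in f:\ \sigma'\in A(f,\sigma)}\rho(\sigma'|f,\sigma)\,\frac{\omega(\sigma)}{\omega(\sigma')}\qquad\text{for all } f\in F,\ \sigma'\in\Omega,$$ and let $\mu\in\mathbb R^F$ be such that one of the following holds. * (Cluster expansion condition) $\mu_f>0$ and $\frac{\lambda_f}{\mu_f}\sum_{S\in\mathrm{Ind}(\Gamma(f))}\prod_{g\in S}\mu_g\le\theta$ for all $f\in F$. * (Shearer's condition) There is $p\in\mathbb R^F$ such that, with $q_S=\sum_{I:\,S\subseteq I\in\mathrm{Ind}(F)}(-1)^{|I|-|S|}\prod_{f\in I}p_f$, we have $q_S\ge0$ for all $S\subseteq F$, $q_\varnothing>0$,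 and $\lambda_f\le\theta p_f$ and $\mu_f=q_{\{f\}}/q_\varnothing$ for all $f\in F$. Consider the following parallel algorithm. Sample $\sigma$ from an arbitrary distribution $\omega^{\rm init}$ on $\Omega$. While $F_\sigma\neq\varnothing$, perform a round: set $I=\varnothing$ and, while $F_\sigma\setminus\Gamma^+(I)\ne\varnothing$, pick some $f\in F_\sigma\setminus\Gamma^+(I)$, replace $\sigma$ by a sample from $\rho(\cdot\,|\,f,\sigma)$, and add $f$ to $I$. The flaws are picked by an arbitrary rule, i.e. from any probability distribution on $F_\sigma\setminus\Gamma^+(I)$ that is a function of the whole past execution history. Let $\gamma^{\rm init}=\max_{\sigma\in\Omega}\omega^{\rm init}(\sigma)/\omega(\sigma)$ and $$T=\frac1{\log\theta^{-1}}\Big(\log\gamma^{\rm init}+\log\sum_{f\in F}\mu_f\Big).$$ Then for every real $r$ with $T+r>0$, the probability that the algorithm produces a flawless object in fewer than $T+r$ rounds is at least $1-\theta^r$. -/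

import Mathlib

open scoped ENNReal

/-- A finite set `Ω` of objects, a finite family of flaws (non-empty subsets of `Ω`), a resampling
oracle `ρ f σ` for every flaw `f` and every object `σ` in which `f` is present, and a symmetric
relation `∼` on flaws (loops `f ∼ f` are allowed).
The set of actions `A(f, σ)` is the support of `ρ f σ`. The values `ρ f σ` with `σ ∉ f` are
irrelevant: nothing below looks at them. -/
structure ResamplingSystem (Ω F : Type*) where
  /-- the set of objects in which a flaw is present -/
  flaw : F → Set Ω
  flaw_nonempty : ∀ f, (flaw f).Nonempty
  /-- the resampling oracles -/
  ρ : F → Ω → PMF Ω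
  /-- the relation `∼` -/
  adj : F → F → Prop
  adj_symm : ∀ f g, adj f g → adj g f

/-- A configuration of the parallel algorithm. -/
structure Config (Ω F : Type*) where
  /-- execution history: the pairs (object, flaw addressed at it) so far, most recent first -/
  hist : List (Ω × F)
  /-- the current object `σ` -/
  state : Ω
  /-- `none`: the outer loop is about to test whether `F_σ` is non-empty;
  `some I`: the inner loop is about to test whether `F_σ - Γ⁺(I)` is non-empty -/
  pc : Option (Finset F)
  /-- the number of rounds started so far -/
  rounds : ℕ

namespace ResamplingSystem

noncomputable section

open Classical in
/-- `F_σ`: the flaws present in `σ`. -/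
def present {Ω F : Type*} [Fintype F] (D : ResamplingSystem Ω F) (σ : Ω) : Finset F :=
  Finset.univ.filter fun f => σ ∈ D.flaw f

open Classical in
/-- `Γ(f)`: the neighbours of `f`. -/
def nbr {Ω F : Type*} [Fintype F] (D : ResamplingSystem Ω F) (f : F) : Finset F :=
  Finset.univ.filter fun g => D.adj f g

open Classical in
/-- `F_σ - Γ⁺(I)`: the flaws present in `σ` that neither belong to `I` nor have a neighbour
in `I`. -/
def available {Ω F : Type*} [Fintype F] (D : ResamplingSystem Ω F) (σ : Ω) (I : Finset F) :
    Finset F :=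
  (D.present σ).filter fun f => ∀ g ∈ I, f ≠ g ∧ ¬ D.adj g f

/-- `σ →[f] σ'` is a valid walk: `f ∈ F_σ` and `σ' ∈ A(f, σ)`. -/
def IsStep {Ω F : Type*} (D : ResamplingSystem Ω F) (σ : Ω) (f : F) (σ' : Ω) : Prop :=
  σ ∈ D.flaw f ∧ σ' ∈ (D.ρ f σ).support

/-- `(F, ∼)` is a potential causality graph for `ρ`:
`F_σ' ⊆ (F_σ - {f}) ∪ Γ(f)` for every walk `σ →[f] σ'`. -/
def IsCausalityGraph {Ω F : Type*} (D : ResamplingSystem Ω F) : Prop :=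
  ∀ (σ : Ω) (f : F) (σ' : Ω), D.IsStep σ f σ' →
    ∀ g, σ' ∈ D.flaw g → (σ ∈ D.flaw g ∧ g ≠ f) ∨ D.adj f g

/-- A walk `σ₁ →[f] σ₂ →[g] σ₃` of length two. -/
@[ext] structure Walk2 {Ω F : Type*} (D : ResamplingSystem Ω F) where
  σ₁ : Ω
  f : F
  σ₂ : Ω
  g : F
  σ₃ : Ω
  step₁ : D.IsStep σ₁ f σ₂
  step₂ : D.IsStep σ₂ g σ₃

/-- The walks `σ₁ →[f] σ₂ →[g] σ₃` with `f ≁ g`. -/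
abbrev SwappableWalk {Ω F : Type*} (D : ResamplingSystem Ω F) :=
  {τ : D.Walk2 // ¬ D.adj τ.f τ.g}

/-- `swap` sends each walk `σ₁ →[f] σ₂ →[g] σ₃` with `f ≁ g` to a valid walk
`σ₁ →[g] σ₂' →[f] σ₃`, and it is injective (weak commutativity asks for such a mapping). -/
def IsSwap {Ω F : Type*} (D : ResamplingSystem Ω F) (swap : D.SwappableWalk → D.Walk2) : Prop :=
  Function.Injective swap ∧
    ∀ τ, (swap τ).σ₁ = τ.1.σ₁ ∧ (swap τ).f = τ.1.g ∧ (swap τ).g = τ.1.f ∧ (swap τ).σ₃ = τ.1.σ₃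

/-- The product `ρ(σ₂ | f, σ₁) ρ(σ₃ | g, σ₂)`. -/
def Walk2.prob {Ω F : Type*} {D : ResamplingSystem Ω F} (τ : D.Walk2) : ℝ≥0∞ :=
  D.ρ τ.f τ.σ₁ τ.σ₂ * D.ρ τ.g τ.σ₂ τ.σ₃

/-- Strong commutativity: weak commutativity, with a mapping that preserves the product of the
two transition probabilities. -/
def StronglyCommutative {Ω F : Type*} (D : ResamplingSystem Ω F) : Prop :=
  ∃ swap : D.SwappableWalk → D.Walk2, D.IsSwap swap ∧ ∀ τ, τ.1.prob = (swap τ).prob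

/-- A set of flaws is independent if no two distinct members are related. -/
def IsIndep {Ω F : Type*} (D : ResamplingSystem Ω F) (S : Finset F) : Prop :=
  ∀ f ∈ S, ∀ g ∈ S, f ≠ g → ¬ D.adj f g

open Classical in
/-- `Ind(S)`: the independent subsets of `S`. -/
def ind {Ω F : Type*} (D : ResamplingSystem Ω F) (S : Finset F) : Finset (Finset F) :=
  S.powerset.filter fun T => D.IsIndep T

open Classical in
/-- `lam` is a vector of flaw charges with respect to the distribution `ω`:
`λ_f ≥ ∑_{σ ∈ f : σ' ∈ A(f,σ)} ρ(σ' | f, σ) ω(σ) / ω(σ')` for all `f` and `σ'`. -/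
def IsCharge {Ω F : Type*} [Fintype Ω] (D : ResamplingSystem Ω F) (ω : PMF Ω)
    (lam : F → ℝ) : Prop :=
  ∀ (f : F) (σ' : Ω),
    ∑ σ ∈ Finset.univ.filter (fun σ => D.IsStep σ f σ'),
      (D.ρ f σ σ').toReal * ((ω σ).toReal / (ω σ').toReal) ≤ lam f

/-- The algorithmic LLL (cluster expansion) condition with a positive vector `mu` and a
constant `θ`. -/
def LLLCondition {Ω F : Type*} [Fintype Ω] [Fintype F] (D : ResamplingSystem Ω F) (ω : PMF Ω)
    (θ : ℝ) (lam mu : F → ℝ) : Prop :=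
  D.IsCharge ω lam ∧ (∀ f, 0 < mu f) ∧
    ∀ f, lam f / mu f * ∑ S ∈ D.ind (D.nbr f), ∏ g ∈ S, mu g ≤ θ

open Classical in
/-- The polynomial `q_S(p) = ∑_{I : S ⊆ I ∈ Ind(F)} (-1)^{|I| - |S|} p^I`. -/
def q {Ω F : Type*} [Fintype F] (D : ResamplingSystem Ω F) (p : F → ℝ) (S : Finset F) : ℝ :=
  ∑ I ∈ (D.ind Finset.univ).filter (fun I => S ⊆ I), (-1) ^ (I.card - S.card) * ∏ f ∈ I, p f

/-- Shearer's condition with a vector `p`, flaw charges `lam` and a constant `θ`. -/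
def ShearerCondition {Ω F : Type*} [Fintype Ω] [Fintype F] (D : ResamplingSystem Ω F)
    (ω : PMF Ω) (θ : ℝ) (lam p : F → ℝ) : Prop :=
  (∀ S, 0 ≤ D.q p S) ∧ 0 < D.q p ∅ ∧ D.IsCharge ω lam ∧ ∀ f, lam f ≤ θ * p f

/-- A rule for the choice `f ∈ F_σ - Γ⁺(I)`: a probability distribution on this set that may
depend arbitrarily on the whole past execution history. -/
structure Strategy {Ω F : Type*} [Fintype F] (D : ResamplingSystem Ω F) where
  select : (hist : List (Ω × F)) → (σ : Ω) → (I : Finset F) → (D.available σ I).Nonempty → PMF F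
  select_mem : ∀ hist σ I h, ∀ f ∈ (select hist σ I h).support, f ∈ D.available σ I

open Classical in
/-- One transition of the parallel algorithm. At the outer loop test: stay there for ever if the
object is flawless, otherwise start a new round with `I = ∅`. At the inner loop test: if
`F_σ - Γ⁺(I)` is non-empty then select one of its flaws `f`, resample `σ` according to
`ρ(· | f, σ)` and add `f` to `I`; otherwise the round ends. -/
def step {Ω F : Type*} [Fintype F] (D : ResamplingSystem Ω F) (Λ : D.Strategy)
    (c : Config Ω F) : PMF (Config Ω F) :=
  match c.pc with
  | none =>
    if D.present c.state = ∅ then PMF.pure c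
    else PMF.pure { c with pc := some ∅, rounds := c.rounds + 1 }
  | some I =>
    if h : (D.available c.state I).Nonempty then
      (Λ.select c.hist c.state I h).bind fun f =>
        (D.ρ f c.state).map fun σ' =>
          { hist := (c.state, f) :: c.hist
            state := σ'
            pc := some (insert f I)
            rounds := c.rounds }
    else PMF.pure { c with pc := none }

/-- The distribution of the configuration after `n` transitions, with the initial object sampled
from `ωinit`. -/
def run {Ω F : Type*} [Fintype F] (D : ResamplingSystem Ω F) (Λ : D.Strategy)
    (ωinit : PMF Ω) : ℕ → PMF (Config Ω F)
  | 0 => ωinit.map fun σ => { hist := [], state := σ, pc := none, rounds := 0 }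
  | n + 1 => (run D Λ ωinit n).bind (D.step Λ)

/-- The algorithm has stopped: the outer loop test fails, so the current object is flawless. -/
def Halted {Ω F : Type*} [Fintype F] (D : ResamplingSystem Ω F) (c : Config Ω F) : Prop :=
  c.pc = none ∧ D.present c.state = ∅

/-- The probability that the parallel algorithm produces a flawless object in fewer than `x`
rounds. A configuration that has stopped never changes again, so the events on the right increase
with `n`, and the supremum is the probability that one of them happens. -/
def probFinish {Ω F : Type*} [Fintype F] (D : ResamplingSystem Ω F) (Λ : D.Strategy)
    (ωinit : PMF Ω) (x : ℝ) : ℝ≥0∞ :=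
  ⨆ n : ℕ, (D.run Λ ωinit n).toOuterMeasure {c | D.Halted c ∧ (c.rounds : ℝ) < x}

end

end ResamplingSystem

/-- `γ^init = max_σ ωinit(σ) / ω(σ)` (for a finite set `Ω`). -/
noncomputable def gammaInit {Ω : Type*} (ωinit ω : PMF Ω) : ℝ :=
  ⨆ σ : Ω, (ωinit σ).toReal / (ω σ).toReal

/-- `T = (log γ^init + log ∑_f μ_f) / log θ⁻¹`. -/
noncomputable def parallelT {Ω F : Type*} [Fintype F] (ωinit ω : PMF Ω) (θ : ℝ) (mu : F → ℝ) : ℝ :=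
  (Real.log (gammaInit ωinit ω) + Real.log (∑ f, mu f)) / Real.log θ⁻¹

/-! Let A_f be the matrix with entries ρ(σ'|f,σ), its rows with σ ∉ f replaced by zero. Strong
commutativity makes A_f and A_g commute whenever f ≁ g (`commute_transMat`), and causality gives
A_f² = 0 whenever f ≁ f (`transMat_mul_self`). The charge condition reads ω A_f ≤ λ_f ω, an
inequality that multiplies along products of matrices.

Choose an addressed flaw and read the history backwards from it, keeping only flaws related to one
already kept and placing each just beyond the last related layer. The result is a layered witness φ
(`wit`). Let A_φ be the product of its matrices, earliest layer first. From an object σ, the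
probability that φ ever occurs is at most (A_φ 1)(σ) (`runFrom_occurs_le`): given the first flaw
addressed, the witness of the remaining execution is determined by φ (`push_injOn`), and
commutativity moves A_f to its layer. Averaging over the initial object bounds the probability by
γ^init times the product of the λ_f over φ.

If some layer is not contained in Γ of the preceding one, then A_φ = 0 (`seqMat_eq_zero_or_chain`),
so only stable sequences contribute. Both conditions on μ provide a supersolution of the recursion
for their weights, whence those with at least s layers have total weight at most θ^s ∑ μ_f
(`IsSupersolution.sum_weight_stab_le`).

Deterministically, every flaw that survives a round is related to one addressed in that round. Hence
R completed rounds, with or without a further one under way, leave a chain of R successively related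
flaws in the history (`Invariant.step`), and such a chain forces a witness with at least R layers
(`exists_length_le_wit`). With s = ⌈T + r⌉, failure has probability at most γ^init θ^s ∑ μ_f ≤ θ^r.
-/

namespace ResamplingSystem

open Finset
open scoped Classical

variable {Ω F : Type*}

/-! ### Independent sets and weights -/

lemma mem_ind {D : ResamplingSystem Ω F} {S T : Finset F} :
    T ∈ D.ind S ↔ T ⊆ S ∧ D.IsIndep T := by
  simp [ind]

lemma IsIndep.mono {D : ResamplingSystem Ω F} {S T : Finset F} (hT : D.IsIndep T) (h : S ⊆ T) :
    D.IsIndep S :=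
  fun f hf g hg => hT f (h hf) g (h hg)

lemma sum_powerset_neg_one_pow_card_real (X : Finset F) :
    ∑ T ∈ X.powerset, (-1 : ℝ) ^ T.card = if X = ∅ then 1 else 0 := by
  have h := congrArg (Int.cast : ℤ → ℝ) (sum_powerset_neg_one_pow_card (x := X))
  push_cast at h
  simpa using h

lemma IsCharge.nonneg [Fintype Ω] {D : ResamplingSystem Ω F} {ω : PMF Ω} {lam : F → ℝ}
    (h : D.IsCharge ω lam) (f : F) : 0 ≤ lam f := by
  -- The flaw serves only to supply an object at which to evaluate the charge inequality.
  obtain ⟨σ, -⟩ := D.flaw_nonempty f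
  exact (sum_nonneg fun _ _ => by positivity).trans (h f σ)

/-- The weight of a sequence of layers. -/
def weight (lam : F → ℝ) (φ : List (Finset F)) : ℝ :=
  (φ.map fun S => ∏ f ∈ S, lam f).prod

lemma weight_nonneg {lam : F → ℝ} (hlam : ∀ f, 0 ≤ lam f) (φ : List (Finset F)) :
    0 ≤ weight lam φ := by
  refine List.prod_nonneg fun a ha => ?_
  obtain ⟨S, -, rfl⟩ := List.mem_map.1 ha
  exact prod_nonneg fun f _ => hlam f

lemma sum_biUnion_le_sum {α β : Type*} [DecidableEq β] (s : Finset α) (t : α → Finset β) (g : β → ℝ)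
    (hg : ∀ b, 0 ≤ g b) : ∑ b ∈ s.biUnion t, g b ≤ ∑ a ∈ s, ∑ b ∈ t a, g b := by
  induction s using Finset.induction_on with
  | empty => simp
  | insert a s ha ih =>
    rw [biUnion_insert, sum_insert ha]
    have h := sum_union_inter (s₁ := t a) (s₂ := s.biUnion t) (f := g)
    have h' : 0 ≤ ∑ b ∈ t a ∩ s.biUnion t, g b := sum_nonneg fun b _ => hg b
    linarith

/-- `f ∈ Γ⁺(S)`. -/
def Related (D : ResamplingSystem Ω F) (f : F) (S : Finset F) : Prop :=
  ∃ g ∈ S, f = g ∨ D.adj g f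

/-- The map T ↦ (T ∩ X, T \ X) is injective into pairs of independent sets and splits the product;
the pairs that it misses have nonnegative weight. -/
lemma sum_ind_union_le (D : ResamplingSystem Ω F) {mu : F → ℝ} (hmu : ∀ f, 0 ≤ mu f)
    (X Y : Finset F) :
    ∑ T ∈ D.ind (X ∪ Y), ∏ f ∈ T, mu f ≤
      (∑ T ∈ D.ind X, ∏ f ∈ T, mu f) * ∑ T ∈ D.ind Y, ∏ f ∈ T, mu f := by
  rw [sum_mul_sum, ← sum_product']
  have hinj : Set.InjOn (fun T : Finset F => (T ∩ X, T \ X)) (D.ind (X ∪ Y)) := by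
    intro T _ T' _ h
    simp only [Prod.mk.injEq] at h
    rw [← sdiff_union_inter T X, ← sdiff_union_inter T' X, h.1, h.2]
  calc ∑ T ∈ D.ind (X ∪ Y), ∏ f ∈ T, mu f
      = ∑ P ∈ (D.ind (X ∪ Y)).image (fun T => (T ∩ X, T \ X)),
          (∏ f ∈ P.1, mu f) * ∏ f ∈ P.2, mu f := by
        rw [sum_image hinj]
        refine sum_congr rfl fun T _ => ?_
        exact (prod_inter_mul_prod_sdiff T X mu).symm
    _ ≤ _ := by
        refine sum_le_sum_of_subset_of_nonneg ?_ fun P _ _ =>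
          mul_nonneg (prod_nonneg fun f _ => hmu f) (prod_nonneg fun f _ => hmu f)
        intro P hP
        obtain ⟨T, hT, rfl⟩ := mem_image.1 hP
        obtain ⟨h1, h2⟩ := mem_ind.1 hT
        refine mem_product.2 ⟨mem_ind.2 ⟨inter_subset_right, h2.mono inter_subset_left⟩,
          mem_ind.2 ⟨?_, h2.mono sdiff_subset⟩⟩
        intro f hf
        have := h1 (mem_sdiff.1 hf).1
        simp only [mem_union, mem_sdiff] at this hf
        tauto

/-! ### Neighbourhoods and the polynomials of Shearer's condition -/

variable [Fintype F]

/-- `Γ(S)`: the flaws with a neighbour in `S`. -/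
noncomputable def nbrs (D : ResamplingSystem Ω F) (S : Finset F) : Finset F :=
  S.biUnion D.nbr

/-- `Γ⁺(S)`. -/
noncomputable def closedNbrs (D : ResamplingSystem Ω F) (S : Finset F) : Finset F :=
  univ.filter fun f => D.Related f S

lemma mem_nbr {D : ResamplingSystem Ω F} {f g : F} : g ∈ D.nbr f ↔ D.adj f g := by
  simp [nbr]

lemma mem_nbrs {D : ResamplingSystem Ω F} {S : Finset F} {g : F} :
    g ∈ D.nbrs S ↔ ∃ f ∈ S, D.adj f g := by
  simp [nbrs, mem_nbr]

lemma mem_closedNbrs {D : ResamplingSystem Ω F} {S : Finset F} {f : F} :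
    f ∈ D.closedNbrs S ↔ D.Related f S := by
  simp [closedNbrs]

lemma nbrs_subset_closedNbrs (D : ResamplingSystem Ω F) (S : Finset F) :
    D.nbrs S ⊆ D.closedNbrs S := by
  intro g hg
  obtain ⟨f, hf, h⟩ := mem_nbrs.1 hg
  exact mem_closedNbrs.2 ⟨f, hf, Or.inr h⟩

lemma sum_ind_nbrs_le (D : ResamplingSystem Ω F) {mu : F → ℝ} (hmu : ∀ f, 0 ≤ mu f)
    (S : Finset F) :
    ∑ T ∈ D.ind (D.nbrs S), ∏ f ∈ T, mu f ≤
      ∏ f ∈ S, ∑ T ∈ D.ind (D.nbr f), ∏ g ∈ T, mu g := by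
  induction S using Finset.induction_on with
  | empty =>
    have : D.ind ∅ = {∅} := by
      ext T
      simp only [mem_ind, subset_empty, mem_singleton]
      exact ⟨fun h => h.1, fun h => ⟨h, by simp [h, IsIndep]⟩⟩
    simp [nbrs, this]
  | insert f S hf ih =>
    rw [prod_insert hf, nbrs, biUnion_insert]
    refine (D.sum_ind_union_le hmu _ _).trans (mul_le_mul_of_nonneg_left ih ?_)
    exact sum_nonneg fun T _ => prod_nonneg fun g _ => hmu g

/-- `∑ (-1)^|I| p^I` over the independent sets `I` disjoint from `X`. -/
noncomputable def indPoly (D : ResamplingSystem Ω F) (p : F → ℝ) (X : Finset F) : ℝ :=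
  ∑ I ∈ (D.ind univ).filter (fun I => Disjoint I X), (-1) ^ I.card * ∏ f ∈ I, p f

/-- Inclusion–exclusion: after exchanging the sums, the coefficient of a fixed I is an alternating
sum over the subsets of X ∩ I, which vanishes unless X ∩ I is empty. -/
lemma sum_powerset_q (D : ResamplingSystem Ω F) (p : F → ℝ) (X : Finset F) :
    ∑ T ∈ X.powerset, D.q p T = D.indPoly p X := by
  unfold q indPoly
  simp_rw [sum_filter]
  rw [sum_comm]
  refine sum_congr rfl fun I _ => ?_
  rw [← sum_filter]
  have h1 : X.powerset.filter (fun T => T ⊆ I) = (X ∩ I).powerset := by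
    ext T
    rw [mem_filter, mem_powerset, mem_powerset, subset_inter_iff]
  have h2 : ∀ T ∈ (X ∩ I).powerset, (-1 : ℝ) ^ (I.card - T.card) * ∏ f ∈ I, p f =
      (-1) ^ T.card * ((-1) ^ I.card * ∏ f ∈ I, p f) := by
    intro T hT
    have hle : T.card ≤ I.card :=
      card_le_card ((mem_powerset.1 hT).trans inter_subset_right)
    obtain ⟨k, hk⟩ := Nat.exists_eq_add_of_le hle
    rw [hk, Nat.add_sub_cancel_left, pow_add, ← mul_assoc, ← mul_assoc, ← mul_pow]
    norm_num
  rw [h1, sum_congr rfl h2, ← sum_mul, sum_powerset_neg_one_pow_card_real]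
  have h3 : X ∩ I = ∅ ↔ Disjoint I X := by
    rw [disjoint_comm, disjoint_iff_inter_eq_empty]
  by_cases h : Disjoint I X
  · simp [h3, h]
  · simp [h3, h]

/-- The independent sets containing S are the unions S ∪ J with J independent and disjoint from
Γ⁺(S), so p^S factors out. -/
lemma q_eq_prod_mul_indPoly (D : ResamplingSystem Ω F) (p : F → ℝ) {S : Finset F}
    (hS : D.IsIndep S) :
    D.q p S = (∏ f ∈ S, p f) * D.indPoly p (D.closedNbrs S) := by
  unfold q indPoly
  rw [mul_sum]
  have hdisj : ∀ J : Finset F, Disjoint J (D.closedNbrs S) → Disjoint S J := by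
    intro J hJ
    rw [disjoint_left] at hJ ⊢
    exact fun f hf hfJ => hJ hfJ (mem_closedNbrs.2 ⟨f, hf, Or.inl rfl⟩)
  refine sum_nbij' (fun I => I \ S) (fun J => S ∪ J) ?_ ?_ ?_ ?_ ?_
  · intro I hI
    obtain ⟨hI, hSI⟩ := mem_filter.1 hI
    have hI := (mem_ind.1 hI).2
    refine mem_filter.2 ⟨mem_ind.2 ⟨subset_univ _, hI.mono sdiff_subset⟩, ?_⟩
    rw [disjoint_left]
    intro f hf hf'
    obtain ⟨g, hg, h⟩ := mem_closedNbrs.1 hf'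
    obtain ⟨hf1, hf2⟩ := mem_sdiff.1 hf
    rcases h with rfl | h
    · exact hf2 hg
    · exact hI g (hSI hg) f hf1 (fun e => hf2 (e ▸ hg)) h
  · intro J hJ
    obtain ⟨hJ, hd⟩ := mem_filter.1 hJ
    have hJ := (mem_ind.1 hJ).2
    refine mem_filter.2 ⟨mem_ind.2 ⟨subset_univ _, ?_⟩, subset_union_left⟩
    rw [disjoint_left] at hd
    intro f hf g hg hne h
    rcases mem_union.1 hf with hf | hf <;> rcases mem_union.1 hg with hg | hg
    · exact hS f hf g hg hne h
    · exact hd hg (mem_closedNbrs.2 ⟨f, hf, Or.inr h⟩)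
    · exact hd hf (mem_closedNbrs.2 ⟨g, hg, Or.inr (D.adj_symm _ _ h)⟩)
    · exact hJ f hf g hg hne h
  · intro I hI
    exact union_sdiff_of_subset (mem_filter.1 hI).2
  · intro J hJ
    exact union_sdiff_cancel_left (hdisj J (mem_filter.1 hJ).2)
  · intro I hI
    have hSI := (mem_filter.1 hI).2
    rw [card_sdiff_of_subset hSI, ← prod_sdiff hSI]
    ring

/-! ### Supersolutions and stable sequences -/

/-- The common consequence of the cluster expansion condition and Shearer's condition:
`v` is a supersolution of the recursion for the total weight of stable sequences. -/
structure IsSupersolution (D : ResamplingSystem Ω F) (θ : ℝ) (lam : F → ℝ)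
    (v : Finset F → ℝ) : Prop where
  nonneg : ∀ S, 0 ≤ v S
  empty : v ∅ = 1
  le : ∀ S, D.IsIndep S →
    (∏ f ∈ S, lam f) * ∑ T ∈ D.ind (D.nbrs S), v T ≤ θ ^ S.card * v S

/-- The independent-set sum is submultiplicative over the union Γ(S) of the sets Γ(f), which reduces
the claim to the cluster expansion inequality for each f ∈ S. -/
lemma LLLCondition.isSupersolution [Fintype Ω] {D : ResamplingSystem Ω F} {ω : PMF Ω} {θ : ℝ}
    {lam mu : F → ℝ} (h : D.LLLCondition ω θ lam mu) :
    D.IsSupersolution θ lam (fun S => ∏ f ∈ S, mu f) := by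
  obtain ⟨hc, hpos, hle⟩ := h
  have hmu : ∀ f, 0 ≤ mu f := fun f => (hpos f).le
  refine ⟨fun S => prod_nonneg fun f _ => hmu f, prod_empty, fun S _ => ?_⟩
  calc (∏ f ∈ S, lam f) * ∑ T ∈ D.ind (D.nbrs S), ∏ f ∈ T, mu f
      ≤ (∏ f ∈ S, lam f) * ∏ f ∈ S, ∑ T ∈ D.ind (D.nbr f), ∏ g ∈ T, mu g :=
        mul_le_mul_of_nonneg_left (D.sum_ind_nbrs_le hmu S) (prod_nonneg fun f _ => hc.nonneg f)
    _ = ∏ f ∈ S, (lam f * ∑ T ∈ D.ind (D.nbr f), ∏ g ∈ T, mu g) := prod_mul_distrib.symm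
    _ ≤ ∏ f ∈ S, (θ * mu f) := by
        refine prod_le_prod (fun f _ => mul_nonneg (hc.nonneg f)
          (sum_nonneg fun T _ => prod_nonneg fun g _ => hmu g)) fun f _ => ?_
        have := hle f
        rwa [div_mul_eq_mul_div, div_le_iff₀ (hpos f)] at this
    _ = θ ^ S.card * ∏ f ∈ S, mu f := by rw [prod_mul_distrib, prod_const]

/-- As q ≥ 0, the sum over Ind(Γ(S)) may be enlarged to all subsets of Γ⁺(S), where it telescopes to
`indPoly`; the factor p^S then turns this into q_S. -/
lemma ShearerCondition.isSupersolution [Fintype Ω] {D : ResamplingSystem Ω F} {ω : PMF Ω} {θ : ℝ}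
    (hθ : 0 < θ) {lam p : F → ℝ} (h : D.ShearerCondition ω θ lam p) :
    D.IsSupersolution θ lam (fun S => D.q p S / D.q p ∅) := by
  obtain ⟨hq, hq0, hc, hle⟩ := h
  have hp : ∀ f, 0 ≤ p f := fun f =>
    nonneg_of_mul_nonneg_right ((hc.nonneg f).trans (hle f)) hθ
  refine ⟨fun S => div_nonneg (hq S) hq0.le, div_self hq0.ne', fun S hS => ?_⟩
  rw [← sum_div, ← mul_div_assoc, ← mul_div_assoc]
  refine div_le_div_of_nonneg_right ?_ hq0.le
  have hsum : ∑ T ∈ D.ind (D.nbrs S), D.q p T ≤ D.indPoly p (D.closedNbrs S) := by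
    rw [← sum_powerset_q]
    refine sum_le_sum_of_subset_of_nonneg (fun T hT => ?_) fun T _ _ => hq T
    exact mem_powerset.2 ((mem_ind.1 hT).1.trans (D.nbrs_subset_closedNbrs S))
  have hlam : ∏ f ∈ S, lam f ≤ θ ^ S.card * ∏ f ∈ S, p f := by
    rw [← prod_const, ← prod_mul_distrib]
    exact prod_le_prod (fun f _ => hc.nonneg f) fun f _ => hle f
  calc (∏ f ∈ S, lam f) * ∑ T ∈ D.ind (D.nbrs S), D.q p T
      ≤ (θ ^ S.card * ∏ f ∈ S, p f) * D.indPoly p (D.closedNbrs S) :=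
        mul_le_mul hlam hsum (sum_nonneg fun T _ => hq T)
          (mul_nonneg (pow_nonneg hθ.le _) (prod_nonneg fun f _ => hp f))
    _ = θ ^ S.card * D.q p S := by rw [D.q_eq_prod_mul_indPoly p hS, mul_assoc]

/-- Stable sequences of at most `n` layers with first layer `S`, written as lists;
the empty layer marks the end of a sequence. -/
noncomputable def stab (D : ResamplingSystem Ω F) : ℕ → Finset F → Finset (List (Finset F))
  | 0, S => if S = ∅ then {[]} else ∅
  | n + 1, S => if S = ∅ then {[]} else
      (D.ind (D.nbrs S)).biUnion fun T => (stab D n T).image (List.cons S)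

/-- The stable sequences of at least `s` layers have total weight at most `θ ^ s * v S`. -/
lemma IsSupersolution.sum_weight_stab_le {D : ResamplingSystem Ω F} {θ : ℝ}
    (hθ0 : 0 ≤ θ) (hθ1 : θ ≤ 1) {lam : F → ℝ} (hlam : ∀ f, 0 ≤ lam f) {v : Finset F → ℝ}
    (hv : D.IsSupersolution θ lam v) (n : ℕ) (s : ℕ) (S : Finset F) (hS : D.IsIndep S) :
    ∑ φ ∈ (D.stab n S).filter (fun φ => s ≤ φ.length), weight lam φ ≤ θ ^ s * v S := by
  -- The empty sequence has weight 1 = v ∅ and is counted only when s = 0.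
  have hnil : ∀ s : ℕ, ∑ φ ∈ ({[]} : Finset (List (Finset F))).filter (fun φ => s ≤ φ.length),
      weight lam φ ≤ θ ^ s * v ∅ := by
    intro s
    rcases s with - | s
    · simp [weight, hv.empty, filter_singleton]
    · simpa [filter_singleton] using mul_nonneg (pow_nonneg hθ0 (s + 1)) (hv.nonneg ∅)
  induction n generalizing s S with
  | zero =>
    unfold stab
    split_ifs with h
    · subst h
      exact hnil s
    · simpa using mul_nonneg (pow_nonneg hθ0 s) (hv.nonneg S)
  | succ n ih =>
    unfold stab
    split_ifs with h
    · subst h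
      exact hnil s
    · rw [filter_biUnion]
      refine (sum_biUnion_le_sum _ _ _ (weight_nonneg hlam)).trans ?_
      have hprod : 0 ≤ ∏ f ∈ S, lam f := prod_nonneg fun f _ => hlam f
      -- Truncated subtraction is intended: s ≤ |φ| + 1 is equivalent to s - 1 ≤ |φ|, also for s =
      -- 0.
      have hT : ∀ T ∈ D.ind (D.nbrs S),
          ∑ φ ∈ ((stab D n T).image (List.cons S)).filter (fun φ => s ≤ φ.length), weight lam φ ≤
            (∏ f ∈ S, lam f) * (θ ^ (s - 1) * v T) := by
        intro T hT
        rw [filter_image, sum_image (fun _ _ _ _ h => List.cons_injective h)]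
        have hw : ∀ φ, weight lam (S :: φ) = (∏ f ∈ S, lam f) * weight lam φ := by
          intro φ
          simp [weight]
        simp_rw [hw, ← mul_sum]
        refine mul_le_mul_of_nonneg_left ?_ hprod
        refine le_trans (le_of_eq (sum_congr (filter_congr fun φ _ => ?_) fun _ _ => rfl))
          (ih (s - 1) T (mem_ind.1 hT).2)
        rw [List.length_cons]
        omega
      refine (sum_le_sum hT).trans ?_
      rw [← mul_sum, ← mul_sum]
      calc (∏ f ∈ S, lam f) * (θ ^ (s - 1) * ∑ T ∈ D.ind (D.nbrs S), v T)
          = θ ^ (s - 1) * ((∏ f ∈ S, lam f) * ∑ T ∈ D.ind (D.nbrs S), v T) := by ring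
        _ ≤ θ ^ (s - 1) * (θ ^ S.card * v S) :=
            mul_le_mul_of_nonneg_left (hv.le S hS) (pow_nonneg hθ0 _)
        _ = θ ^ (s - 1 + S.card) * v S := by rw [pow_add, mul_assoc]
        -- A nonempty layer supplies at least one factor θ, which pays for that layer.
        _ ≤ θ ^ s * v S := by
            refine mul_le_mul_of_nonneg_right (pow_le_pow_of_le_one hθ0 hθ1 ?_) (hv.nonneg S)
            have := card_pos.2 (nonempty_iff_ne_empty.2 h)
            omega

end ResamplingSystem

namespace ResamplingSystem

open Finset Matrix
open scoped Classical

variable {Ω F : Type*}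

/-! ### Transition matrices -/

/-- The transition matrix of a flaw; rows of objects without the flaw vanish. -/
noncomputable def transMat (D : ResamplingSystem Ω F) (f : F) : Matrix Ω Ω ℝ≥0∞ :=
  fun σ σ' => if σ ∈ D.flaw f then D.ρ f σ σ' else 0

lemma transMat_ne_zero {D : ResamplingSystem Ω F} {f : F} {σ σ' : Ω} :
    D.transMat f σ σ' ≠ 0 ↔ D.IsStep σ f σ' := by
  unfold transMat IsStep
  rw [PMF.mem_support_iff]
  by_cases h : σ ∈ D.flaw f <;> simp [h]

lemma transMat_of_isStep {D : ResamplingSystem Ω F} {f : F} {σ σ' : Ω} (h : D.IsStep σ f σ') :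
    D.transMat f σ σ' = D.ρ f σ σ' :=
  if_pos h.1

variable [Fintype Ω]

/-- Each entry sums over the middle objects of walks. Once the endpoints and flaws are fixed, a
swapped walk is determined by its middle object, so the swap injects the terms of one sum into those
of the other with equal values. -/
lemma transMat_mul_le {D : ResamplingSystem Ω F} (hcomm : D.StronglyCommutative) {f g : F}
    (hfg : ¬ D.adj f g) (σ₁ σ₃ : Ω) :
    (D.transMat f * D.transMat g) σ₁ σ₃ ≤ (D.transMat g * D.transMat f) σ₁ σ₃ := by
  obtain ⟨swap, ⟨hinj, hswap⟩, hprob⟩ := hcomm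
  simp only [Matrix.mul_apply]
  let P : Ω → Prop := fun σ => D.IsStep σ₁ f σ ∧ D.IsStep σ g σ₃
  let τ : ∀ σ, P σ → D.SwappableWalk := fun σ h => ⟨⟨σ₁, f, σ, g, σ₃, h.1, h.2⟩, hfg⟩
  let m : Ω → Ω := fun σ => if h : P σ then (swap (τ σ h)).σ₂ else σ
  have hm : ∀ σ (h : P σ), m σ = (swap (τ σ h)).σ₂ := fun σ h => dif_pos h
  rw [← Finset.sum_filter_of_ne (p := P)]
  · have hinj' : Set.InjOn m (Finset.univ.filter P) := by
      intro σ hσ σ' hσ' he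
      have h := (mem_filter.1 hσ).2
      have h' := (mem_filter.1 hσ').2
      rw [hm σ h, hm σ' h'] at he
      have e1 := hswap (τ σ h)
      have e2 := hswap (τ σ' h')
      have : swap (τ σ h) = swap (τ σ' h') := by
        apply Walk2.ext
        · rw [e1.1, e2.1]
        · rw [e1.2.1, e2.2.1]
        · exact he
        · rw [e1.2.2.1, e2.2.2.1]
        · rw [e1.2.2.2, e2.2.2.2]
      exact congrArg (fun τ : D.SwappableWalk => τ.1.σ₂) (hinj this)
    calc ∑ σ ∈ Finset.univ.filter P, D.transMat f σ₁ σ * D.transMat g σ σ₃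
        = ∑ σ ∈ Finset.univ.filter P, D.transMat g σ₁ (m σ) * D.transMat f (m σ) σ₃ := by
          refine sum_congr rfl fun σ hσ => ?_
          have h := (mem_filter.1 hσ).2
          rw [hm σ h, transMat_of_isStep h.1, transMat_of_isStep h.2]
          have hp := hprob (τ σ h)
          obtain ⟨e1, e2, e3, e4⟩ := hswap (τ σ h)
          have s1 := (swap (τ σ h)).step₁
          have s2 := (swap (τ σ h)).step₂
          unfold Walk2.prob at hp
          rw [← transMat_of_isStep s1, ← transMat_of_isStep s2, e1, e2, e3, e4] at hp
          exact hp
      _ = ∑ σ ∈ (Finset.univ.filter P).image m, D.transMat g σ₁ σ * D.transMat f σ σ₃ :=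
          by rw [sum_image hinj']
      _ ≤ _ := sum_le_sum_of_subset (subset_univ _)
  · intro σ _ h
    exact ⟨transMat_ne_zero.1 (left_ne_zero_of_mul h), transMat_ne_zero.1 (right_ne_zero_of_mul h)⟩

lemma commute_transMat {D : ResamplingSystem Ω F} (hcomm : D.StronglyCommutative) {f g : F}
    (hfg : ¬ D.adj f g) : Commute (D.transMat f) (D.transMat g) := by
  ext σ₁ σ₃
  exact le_antisymm (transMat_mul_le hcomm hfg σ₁ σ₃)
    (transMat_mul_le hcomm (fun h => hfg (D.adj_symm _ _ h)) σ₁ σ₃)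

lemma transMat_mul_self {D : ResamplingSystem Ω F} (hcausal : D.IsCausalityGraph) {f : F}
    (hf : ¬ D.adj f f) : D.transMat f * D.transMat f = 0 := by
  ext σ₁ σ₃
  rw [Matrix.mul_apply, Matrix.zero_apply]
  refine sum_eq_zero fun σ _ => ?_
  by_contra h
  have h1 := transMat_ne_zero.1 (left_ne_zero_of_mul h)
  have h2 := transMat_ne_zero.1 (right_ne_zero_of_mul h)
  rcases hcausal _ _ _ h1 f h2.1 with h | h
  · exact h.2 rfl
  · exact hf h

/-- The product of the transition matrices of the flaws of a layer. -/
noncomputable def layerMat (D : ResamplingSystem Ω F) (S : Finset F) : Matrix Ω Ω ℝ≥0∞ :=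
  (S.toList.map D.transMat).prod

/-- The order of `toList` is arbitrary, but the matrices of an independent layer commute pairwise,
so any permutation gives the same product. -/
lemma layerMat_insert {D : ResamplingSystem Ω F} (hcomm : D.StronglyCommutative) {f : F}
    {S : Finset F} (hf : f ∉ S) (hS : D.IsIndep (insert f S)) :
    D.layerMat (insert f S) = D.transMat f * D.layerMat S := by
  have hperm : ((insert f S).toList.map D.transMat).Perm ((f :: S.toList).map D.transMat) :=
    (toList_insert hf).map _
  have hpair : ((insert f S).toList.map D.transMat).Pairwise Commute := by
    rw [List.pairwise_map]
    refine (nodup_toList (insert f S)).imp_of_mem fun {a b} ha hb hab => ?_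
    exact commute_transMat hcomm (hS a (mem_toList.1 ha) b (mem_toList.1 hb) hab)
  unfold layerMat
  rw [hperm.prod_eq' hpair, List.map_cons, List.prod_cons]

/-- The matrix of a sequence of layers, the first layer being the most recent one. -/
noncomputable def seqMat (D : ResamplingSystem Ω F) : List (Finset F) → Matrix Ω Ω ℝ≥0∞
  | [] => 1
  | S :: φ => seqMat D φ * D.layerMat S

lemma layerMat_singleton (D : ResamplingSystem Ω F) (f : F) :
    D.layerMat {f} = D.transMat f := by
  simp [layerMat]

lemma commute_layerMat {D : ResamplingSystem Ω F} (hcomm : D.StronglyCommutative) {f : F}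
    {S : Finset F} (h : ¬ D.Related f S) : Commute (D.transMat f) (D.layerMat S) := by
  refine Commute.list_prod_right _ _ fun x hx => ?_
  obtain ⟨g, hg, rfl⟩ := List.mem_map.1 hx
  refine commute_transMat hcomm fun hfg => h ⟨g, mem_toList.1 hg, Or.inr (D.adj_symm _ _ hfg)⟩

lemma commute_seqMat {D : ResamplingSystem Ω F} (hcomm : D.StronglyCommutative) {f : F}
    {φ : List (Finset F)} (h : ∀ S ∈ φ, ¬ D.Related f S) :
    Commute (D.transMat f) (D.seqMat φ) := by
  induction φ with
  | nil => exact Commute.one_right _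
  | cons S φ ih =>
    exact (ih fun T hT => h T (List.mem_cons_of_mem _ hT)).mul_right
      (commute_layerMat hcomm (h S List.mem_cons_self))

/-! ### Charges -/

/-- `ω M ≤ c ω` entrywise. -/
def ChargedBy (ω : Ω → ℝ≥0∞) (M : Matrix Ω Ω ℝ≥0∞) (c : ℝ≥0∞) : Prop :=
  ∀ σ', ∑ σ, ω σ * M σ σ' ≤ c * ω σ'

lemma ChargedBy.one (ω : Ω → ℝ≥0∞) : ChargedBy ω 1 1 := by
  intro σ'
  simp [Matrix.one_apply]

lemma ChargedBy.mul {ω : Ω → ℝ≥0∞} {M N : Matrix Ω Ω ℝ≥0∞} {a b : ℝ≥0∞}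
    (hM : ChargedBy ω M a) (hN : ChargedBy ω N b) : ChargedBy ω (M * N) (a * b) := by
  intro σ'
  simp only [Matrix.mul_apply, mul_sum]
  rw [sum_comm]
  calc ∑ τ, ∑ σ, ω σ * (M σ τ * N τ σ')
      = ∑ τ, (∑ σ, ω σ * M σ τ) * N τ σ' := by
        simp only [sum_mul, mul_assoc]
    _ ≤ ∑ τ, a * ω τ * N τ σ' := sum_le_sum fun τ _ => mul_le_mul_left (hM τ) _
    _ = a * ∑ τ, ω τ * N τ σ' := by simp only [mul_sum, mul_assoc]
    _ ≤ a * (b * ω σ') := mul_le_mul_right (hN σ') _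
    _ = a * b * ω σ' := (mul_assoc _ _ _).symm

lemma IsCharge.chargedBy {D : ResamplingSystem Ω F} {ω : PMF Ω} (hω : ∀ σ, 0 < ω σ)
    {lam : F → ℝ} (h : D.IsCharge ω lam) (f : F) :
    ChargedBy ω (D.transMat f) (ENNReal.ofReal (lam f)) := by
  intro σ'
  have hpos : 0 < (ω σ').toReal := ENNReal.toReal_pos (hω σ').ne' (ω.apply_ne_top σ')
  have hfin : ∀ σ, ω σ * D.transMat f σ σ' ≠ ∞ := by
    intro σ
    refine ENNReal.mul_ne_top (ω.apply_ne_top σ) ?_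
    unfold transMat
    split_ifs
    · exact PMF.apply_ne_top _ _
    · exact ENNReal.zero_ne_top
  rw [← ENNReal.ofReal_toReal (ω.apply_ne_top σ'), ← ENNReal.ofReal_mul (h.nonneg f)]
  refine ENNReal.le_ofReal_iff_toReal_le (ENNReal.sum_ne_top.2 fun σ _ => hfin σ)
    (mul_nonneg (h.nonneg f) hpos.le) |>.2 ?_
  rw [ENNReal.toReal_sum fun σ _ => hfin σ]
  have h1 := mul_le_mul_of_nonneg_right (h f σ') hpos.le
  refine le_trans (le_of_eq ?_) h1
  rw [sum_mul, sum_filter]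
  refine sum_congr rfl fun σ _ => ?_
  split_ifs with hs
  · rw [transMat_of_isStep hs, ENNReal.toReal_mul]
    field_simp
  · rw [not_not.1 (fun h0 => hs (transMat_ne_zero.1 h0)), mul_zero, ENNReal.toReal_zero]

lemma IsCharge.chargedBy_layerMat {D : ResamplingSystem Ω F} {ω : PMF Ω} (hω : ∀ σ, 0 < ω σ)
    {lam : F → ℝ} (h : D.IsCharge ω lam) (S : Finset F) :
    ChargedBy ω (D.layerMat S) (ENNReal.ofReal (∏ f ∈ S, lam f)) := by
  unfold layerMat
  rw [← Finset.prod_map_toList]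
  induction S.toList with
  | nil => simpa using ChargedBy.one ω
  | cons f l ih =>
    rw [List.map_cons, List.prod_cons, List.map_cons, List.prod_cons,
      ENNReal.ofReal_mul (h.nonneg f)]
    exact (h.chargedBy hω f).mul ih

lemma IsCharge.chargedBy_seqMat {D : ResamplingSystem Ω F} {ω : PMF Ω} (hω : ∀ σ, 0 < ω σ)
    {lam : F → ℝ} (h : D.IsCharge ω lam) (φ : List (Finset F)) :
    ChargedBy ω (D.seqMat φ) (ENNReal.ofReal (weight lam φ)) := by
  induction φ with
  | nil => simpa [seqMat, weight] using ChargedBy.one ω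
  | cons S φ ih =>
    have : weight lam (S :: φ) = weight lam φ * ∏ f ∈ S, lam f := by
      simp [weight, mul_comm]
    rw [this, ENNReal.ofReal_mul (weight_nonneg h.nonneg φ)]
    exact ih.mul (h.chargedBy_layerMat hω S)

lemma ChargedBy.sum_mulVec_one_le {ω : PMF Ω} {M : Matrix Ω Ω ℝ≥0∞} {c : ℝ≥0∞}
    (h : ChargedBy ω M c) : ∑ σ, ω σ * (M *ᵥ 1) σ ≤ c := by
  simp only [Matrix.mulVec, dotProduct, Pi.one_apply, mul_one, mul_sum]
  rw [sum_comm]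
  refine (sum_le_sum fun σ' _ => h σ').trans ?_
  rw [← mul_sum, ← tsum_fintype (L := .unconditional _), ω.tsum_coe, mul_one]

end ResamplingSystem

namespace ResamplingSystem

open Finset Matrix
open scoped Classical

variable {Ω F : Type*}

/-! ### Bounds on probabilities of events -/

lemma toOuterMeasure_bind_le {α β : Type*} (p : PMF α) (k : α → PMF β) (s : Set β) (b : ℝ≥0∞)
    (h : ∀ a ∈ p.support, (k a).toOuterMeasure s ≤ b) : (p.bind k).toOuterMeasure s ≤ b := by
  rw [PMF.toOuterMeasure_bind_apply]
  calc ∑' a, p a * (k a).toOuterMeasure s ≤ ∑' a, p a * b := by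
        refine ENNReal.tsum_le_tsum fun a => ?_
        by_cases ha : p a = 0
        · simp [ha]
        · exact mul_le_mul_right (h a ((PMF.mem_support_iff _ _).2 ha)) _
    _ = b := by rw [ENNReal.tsum_mul_right, PMF.tsum_coe, one_mul]

lemma toOuterMeasure_le_one {α : Type*} (p : PMF α) (s : Set α) : p.toOuterMeasure s ≤ 1 := by
  rw [PMF.toOuterMeasure_apply, ← p.tsum_coe]
  exact ENNReal.tsum_le_tsum fun a => Set.indicator_le_self _ _ _

/-! ### Witness sequences -/

/-- `f ∈ Γ⁺(S)` for some layer `S`. -/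
def RelatedSeq (D : ResamplingSystem Ω F) (f : F) (φ : List (Finset F)) : Prop :=
  ∃ S ∈ φ, D.Related f S

/-- Adds `f` right after the last layer related to `f`. -/
noncomputable def ins (D : ResamplingSystem Ω F) (f : F) : List (Finset F) → List (Finset F)
  | [] => [{f}]
  | S :: φ => if D.RelatedSeq f (S :: φ) then S :: ins D f φ else insert f S :: φ

/-- Scans one more (earlier) flaw: it is kept if some flaw kept so far depends on it. -/
noncomputable def push (D : ResamplingSystem Ω F) (φ : List (Finset F)) (f : F) :
    List (Finset F) :=
  if φ = [] ∨ D.RelatedSeq f φ then D.ins f φ else φ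

/-- The witness sequence of a list of flaws, the most recent one first. -/
noncomputable def wit (D : ResamplingSystem Ω F) (l : List F) : List (Finset F) :=
  l.foldl D.push []

/-- Removes `f` from the last layer containing it. -/
noncomputable def del (f : F) : List (Finset F) → List (Finset F)
  | [] => []
  | S :: φ => if ∃ T ∈ φ, f ∈ T then S :: del f φ else
      if S.erase f = ∅ then φ else S.erase f :: φ

lemma Related.of_mem {D : ResamplingSystem Ω F} {f : F} {S : Finset F} (h : f ∈ S) :
    D.Related f S :=
  ⟨f, h, Or.inl rfl⟩

lemma relatedSeq_cons {D : ResamplingSystem Ω F} {f : F} {S : Finset F} {φ : List (Finset F)} :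
    D.RelatedSeq f (S :: φ) ↔ D.Related f S ∨ D.RelatedSeq f φ := by
  simp [RelatedSeq]

lemma not_relatedSeq_nil {D : ResamplingSystem Ω F} {f : F} : ¬ D.RelatedSeq f [] := by
  simp [RelatedSeq]

lemma exists_mem_ins (D : ResamplingSystem Ω F) (f : F) (φ : List (Finset F)) :
    ∃ S ∈ D.ins f φ, f ∈ S := by
  induction φ with
  | nil => exact ⟨{f}, by simp [ins]⟩
  | cons S φ ih =>
    unfold ins
    split_ifs with h
    · obtain ⟨T, hT, hf⟩ := ih
      exact ⟨T, List.mem_cons_of_mem _ hT, hf⟩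
    · exact ⟨_, List.mem_cons_self, mem_insert_self _ _⟩

/-- The layer that receives f is the last one containing f, and did not contain it before. Erasing f
leaves ∅ exactly when that layer was created for f, since old layers are nonempty. -/
lemma del_ins (D : ResamplingSystem Ω F) (f : F) {φ : List (Finset F)}
    (hφ : ∀ S ∈ φ, S.Nonempty) : del f (D.ins f φ) = φ := by
  induction φ with
  | nil => simp [ins, del]
  | cons S φ ih =>
    unfold ins
    split_ifs with h
    · rw [del, if_pos (D.exists_mem_ins f φ), ih fun T hT => hφ T (List.mem_cons_of_mem _ hT)]
    · have hS : f ∉ S := fun hf => h ⟨S, List.mem_cons_self, .of_mem hf⟩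
      have h1 : ¬ ∃ T ∈ φ, f ∈ T := fun ⟨T, hT, hf⟩ =>
        h ⟨T, List.mem_cons_of_mem _ hT, .of_mem hf⟩
      rw [del, if_neg h1, erase_insert hS,
        if_neg (hφ S List.mem_cons_self).ne_empty]

/-- `push` is injective on sequences of nonempty layers. -/
lemma push_injOn (D : ResamplingSystem Ω F) (f : F) {φ ψ : List (Finset F)}
    (hφ : ∀ S ∈ φ, S.Nonempty) (hψ : ∀ S ∈ ψ, S.Nonempty) (h : D.push φ f = D.push ψ f) :
    φ = ψ := by
  -- An insertion always leaves f in some layer, hence never yields a sequence from which f would be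
  -- discarded.
  have key : ∀ χ χ' : List (Finset F), ¬ (χ' = [] ∨ D.RelatedSeq f χ') → D.ins f χ ≠ χ' := by
    rintro χ χ' hn rfl
    obtain ⟨S, hS, hf⟩ := D.exists_mem_ins f χ
    exact hn (Or.inr ⟨S, hS, .of_mem hf⟩)
  unfold push at h
  split_ifs at h with h1 h2 h2
  · rw [← D.del_ins f hφ, h, D.del_ins f hψ]
  · exact absurd h (key _ _ h2)
  · exact absurd h.symm (key _ _ h1)
  · exact h

/-- Nonempty independent layers, each contained in `Γ⁺` of the preceding one, and a single root. -/
structure IsWitness (D : ResamplingSystem Ω F) (φ : List (Finset F)) : Prop where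
  nonempty : ∀ S ∈ φ, S.Nonempty
  indep : ∀ S ∈ φ, D.IsIndep S
  chain : φ.IsChain fun S T => ∀ f ∈ T, D.Related f S
  root : ∀ S ∈ φ.head?, ∃ f, S = {f}

lemma isIndep_singleton (D : ResamplingSystem Ω F) (f : F) : D.IsIndep {f} := by
  intro a ha b hb hab
  rw [mem_singleton] at ha hb
  exact absurd (ha.trans hb.symm) hab

lemma isIndep_insert {D : ResamplingSystem Ω F} {f : F} {S : Finset F} (hS : D.IsIndep S)
    (hf : ¬ D.Related f S) : D.IsIndep (insert f S) := by
  intro a ha b hb hab h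
  rcases mem_insert.1 ha with ha' | ha' <;> rcases mem_insert.1 hb with hb' | hb'
  · exact hab (ha'.trans hb'.symm)
  · exact hf ⟨b, hb', Or.inr (ha' ▸ D.adj_symm _ _ h)⟩
  · exact hf ⟨a, ha', Or.inr (hb' ▸ h)⟩
  · exact hS a ha' b hb' hab h

lemma ins_nonempty {D : ResamplingSystem Ω F} {f : F} {φ : List (Finset F)}
    (h : ∀ S ∈ φ, S.Nonempty) : ∀ S ∈ D.ins f φ, S.Nonempty := by
  induction φ with
  | nil => simp [ins]
  | cons S φ ih =>
    rw [List.forall_mem_cons] at h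
    unfold ins
    split_ifs
    · exact List.forall_mem_cons.2 ⟨h.1, ih h.2⟩
    · exact List.forall_mem_cons.2 ⟨insert_nonempty _ _, h.2⟩

lemma ins_indep {D : ResamplingSystem Ω F} {f : F} {φ : List (Finset F)}
    (h : ∀ S ∈ φ, D.IsIndep S) : ∀ S ∈ D.ins f φ, D.IsIndep S := by
  induction φ with
  | nil => simpa [ins] using D.isIndep_singleton f
  | cons S φ ih =>
    rw [List.forall_mem_cons] at h
    unfold ins
    split_ifs with hr
    · exact List.forall_mem_cons.2 ⟨h.1, ih h.2⟩
    · exact List.forall_mem_cons.2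
        ⟨isIndep_insert h.1 fun h' => hr (relatedSeq_cons.2 (Or.inl h')), h.2⟩

/-- If f enters T, the scan stopped there because f is unrelated to T and everything beyond, so it
is related to the layer before T. Enlarging T keeps the next layer inside Γ⁺(T). -/
lemma chain_cons_ins {D : ResamplingSystem Ω F} {f : F} {S : Finset F} {φ : List (Finset F)}
    (hr : D.RelatedSeq f (S :: φ))
    (h : (S :: φ).IsChain fun S T => ∀ g ∈ T, D.Related g S) :
    (S :: D.ins f φ).IsChain fun S T => ∀ g ∈ T, D.Related g S := by
  induction φ generalizing S with
  | nil =>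
    have : D.Related f S := (relatedSeq_cons.1 hr).resolve_right not_relatedSeq_nil
    simpa [ins] using this
  | cons T φ ih =>
    rw [List.isChain_cons_cons] at h
    unfold ins
    split_ifs with hr'
    · exact List.isChain_cons_cons.2 ⟨h.1, ih hr' h.2⟩
    · have hS : D.Related f S := (relatedSeq_cons.1 hr).resolve_right hr'
      refine List.isChain_cons_cons.2 ⟨fun g hg => ?_, ?_⟩
      · rcases mem_insert.1 hg with rfl | hg
        · exact hS
        · exact h.1 g hg
      · cases φ with
        | nil => exact List.isChain_singleton _
        | cons U φ =>
          have h2 := List.isChain_cons_cons.1 h.2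
          refine List.isChain_cons_cons.2 ⟨fun g hg => ?_, h2.2⟩
          obtain ⟨g', hg', h'⟩ := h2.1 g hg
          exact ⟨g', mem_insert_of_mem hg', h'⟩

lemma isWitness_nil (D : ResamplingSystem Ω F) : D.IsWitness [] :=
  ⟨by simp, by simp, List.isChain_nil, by simp⟩

lemma IsWitness.push {D : ResamplingSystem Ω F} {φ : List (Finset F)} (h : D.IsWitness φ)
    (f : F) : D.IsWitness (D.push φ f) := by
  unfold ResamplingSystem.push
  split_ifs with hr
  · refine ⟨ins_nonempty h.nonempty, ins_indep h.indep, ?_, ?_⟩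
    · cases φ with
      | nil => exact List.isChain_singleton _
      | cons S φ =>
        have hr : D.RelatedSeq f (S :: φ) := hr.resolve_left (List.cons_ne_nil _ _)
        rw [ins, if_pos hr]
        exact chain_cons_ins hr h.chain
    · cases φ with
      | nil => simp [ins]
      | cons S φ =>
        have hr : D.RelatedSeq f (S :: φ) := hr.resolve_left (List.cons_ne_nil _ _)
        rw [ins, if_pos hr]
        simpa using h.root
  · exact h

lemma IsWitness.foldl_push {D : ResamplingSystem Ω F} {φ : List (Finset F)} (h : D.IsWitness φ)
    (l : List F) : D.IsWitness (l.foldl D.push φ) := by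
  induction l generalizing φ with
  | nil => exact h
  | cons f l ih => exact ih (h.push f)

lemma isWitness_wit (D : ResamplingSystem Ω F) (l : List F) : D.IsWitness (D.wit l) :=
  D.isWitness_nil.foldl_push l

lemma wit_append_singleton (D : ResamplingSystem Ω F) (l : List F) (f : F) :
    D.wit (l ++ [f]) = D.push (D.wit l) f := by
  simp [wit]

/-! ### The depth of a witness sequence -/

/-- `f` lies in a layer of index at least `j` (the root having index `0`). -/
def IsDeep (φ : List (Finset F)) (f : F) (j : ℕ) : Prop :=
  ∃ S ∈ φ.drop j, f ∈ S

lemma IsDeep.lt_length {φ : List (Finset F)} {f : F} {j : ℕ} (h : IsDeep φ f j) :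
    j < φ.length := by
  obtain ⟨S, hS, -⟩ := h
  have := List.length_pos_of_mem hS
  rw [List.length_drop] at this
  omega

lemma IsDeep.ins {φ : List (Finset F)} {g : F} {j : ℕ} (h : IsDeep φ g j)
    (D : ResamplingSystem Ω F) (f : F) : IsDeep (D.ins f φ) g j := by
  induction φ generalizing j with
  | nil => simp [IsDeep] at h
  | cons S φ ih =>
    unfold ResamplingSystem.ins
    obtain ⟨T, hT, hg⟩ := h
    cases j with
    | zero =>
      rw [List.drop_zero, List.mem_cons] at hT
      split_ifs
      · rcases hT with rfl | hT
        · exact ⟨T, List.mem_cons_self, hg⟩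
        · obtain ⟨U, hU, hgU⟩ := ih (j := 0) ⟨T, hT, hg⟩
          exact ⟨U, List.mem_cons_of_mem _ hU, hgU⟩
      · rcases hT with rfl | hT
        · exact ⟨_, List.mem_cons_self, mem_insert_of_mem hg⟩
        · exact ⟨T, List.mem_cons_of_mem _ hT, hg⟩
    | succ j =>
      split_ifs
      · exact ih (j := j) ⟨T, hT, hg⟩
      · exact ⟨T, hT, hg⟩

lemma IsDeep.push {φ : List (Finset F)} {g : F} {j : ℕ} (h : IsDeep φ g j)
    (D : ResamplingSystem Ω F) (f : F) : IsDeep (D.push φ f) g j := by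
  unfold ResamplingSystem.push
  split_ifs
  · exact h.ins D f
  · exact h

/-- Insertion passes every related layer, so f lands strictly beyond a related layer of index at
least j. -/
lemma isDeep_ins_succ (D : ResamplingSystem Ω F) {φ : List (Finset F)} {f : F} {j : ℕ}
    (h : D.RelatedSeq f (φ.drop j)) : IsDeep (D.ins f φ) f (j + 1) := by
  induction φ generalizing j with
  | nil => simp [RelatedSeq] at h
  | cons S φ ih =>
    have hr : D.RelatedSeq f (S :: φ) := by
      obtain ⟨T, hT, hf⟩ := h
      exact ⟨T, List.mem_of_mem_drop hT, hf⟩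
    rw [ins, if_pos hr]
    cases j with
    | zero =>
      exact D.exists_mem_ins f φ
    | succ j => exact ih h

lemma IsDeep.push_succ {φ : List (Finset F)} {f g : F} {j : ℕ} (h : IsDeep φ g j)
    (D : ResamplingSystem Ω F) (hfg : g = f ∨ D.adj g f) : IsDeep (D.push φ f) f (j + 1) := by
  obtain ⟨S, hS, hg⟩ := h
  have hr : D.Related f S := ⟨g, hg, hfg.imp Eq.symm id⟩
  unfold ResamplingSystem.push
  rw [if_pos (Or.inr ⟨S, List.mem_of_mem_drop hS, hr⟩)]
  exact D.isDeep_ins_succ ⟨S, hS, hr⟩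

lemma IsDeep.add_length_lt {D : ResamplingSystem Ω F} {l h : List F} (hl : l.Sublist h)
    {φ : List (Finset F)} {g : F} {j : ℕ} (hφ : IsDeep φ g j)
    (hc : (g :: l).IsChain fun a b => a = b ∨ D.adj a b) :
    j + l.length < (h.foldl D.push φ).length := by
  induction hl generalizing φ g j with
  | slnil => exact hφ.lt_length
  | cons a _ ih => exact ih (hφ.push D a) hc
  | cons_cons a _ ih =>
    rw [List.isChain_cons_cons] at hc
    have := ih (hφ.push_succ D hc.1) hc.2
    simp only [List.length_cons, List.foldl_cons] at this ⊢
    omega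

/-- A chain of related flaws inside a list forces some suffix to have a long witness. -/
lemma exists_length_le_wit (D : ResamplingSystem Ω F) {l h : List F} (hl : l.Sublist h)
    (hc : l.IsChain fun a b => a = b ∨ D.adj a b) :
    ∃ v u, h = v ++ u ∧ l.length ≤ (D.wit u).length := by
  cases l with
  | nil => exact ⟨h, [], by simp, by simp⟩
  | cons f l =>
    obtain ⟨r₁, r₂, rfl, h1, h2⟩ := List.cons_sublist_iff.1 hl
    -- The witness is rooted at the most recent flaw of the chain; each further chain member then
    -- lands at least one layer deeper.
    obtain ⟨v, u, rfl⟩ := List.append_of_mem h1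
    refine ⟨v, f :: (u ++ r₂), by simp, ?_⟩
    have hdeep : IsDeep (D.push [] f) f 0 := by
      rw [push, if_pos (Or.inl rfl)]
      exact D.exists_mem_ins f []
    have := IsDeep.add_length_lt (D := D) (h2.trans (List.sublist_append_right u r₂)) hdeep hc
    rw [wit, List.foldl_cons, List.length_cons]
    omega

lemma mem_stab [Fintype F] {D : ResamplingSystem Ω F} {n : ℕ} {S : Finset F} {φ : List (Finset F)}
    (hlen : φ.length < n) (hne : ∀ T ∈ S :: φ, T.Nonempty) (hind : ∀ T ∈ φ, D.IsIndep T)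
    (hc : (S :: φ).IsChain fun S T => T ⊆ D.nbrs S) : S :: φ ∈ D.stab n S := by
  induction n generalizing S φ with
  | zero => exact absurd hlen (Nat.not_lt_zero _)
  | succ n ih =>
    rw [List.forall_mem_cons] at hne
    rw [stab, if_neg hne.1.ne_empty, mem_biUnion]
    cases φ with
    | nil =>
      -- The empty layer after the last one closes the sequence.
      refine ⟨∅, mem_ind.2 ⟨empty_subset _, by simp [IsIndep]⟩, mem_image_of_mem _ ?_⟩
      cases n <;> simp [stab]
    | cons T φ =>
      rw [List.isChain_cons_cons] at hc
      rw [List.forall_mem_cons] at hind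
      refine ⟨T, mem_ind.2 ⟨hc.1, hind.1⟩, mem_image_of_mem _ (ih ?_ hne.2 hind.2 hc.2)⟩
      rw [List.length_cons] at hlen
      omega

/-- The configurations for which `φ` is the witness of some initial part of the execution that
followed the history `h`. -/
def Occurs (D : ResamplingSystem Ω F) (h : List (Ω × F)) (φ : List (Finset F)) :
    Set (Config Ω F) :=
  {c' | ∃ v u, c'.hist = v ++ (u ++ h) ∧ D.wit (u.map Prod.snd) = φ}

/-- The oldest entry x after `h` is scanned last, so it is the final `push`; φ ≠ [] guarantees that
the scanned part reaches x. -/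
lemma Occurs.exists_cons {D : ResamplingSystem Ω F} {h : List (Ω × F)} {x : Ω × F}
    {φ : List (Finset F)} (hφ : φ ≠ []) {c' : Config Ω F} (hc' : (x :: h) <:+ c'.hist)
    (ho : c' ∈ D.Occurs h φ) :
    ∃ ψ, D.IsWitness ψ ∧ D.push ψ x.2 = φ ∧ c' ∈ D.Occurs (x :: h) ψ := by
  obtain ⟨v, u, hvu, hw⟩ := ho
  obtain ⟨w, hw'⟩ := hc'
  rcases List.eq_nil_or_concat' u with rfl | ⟨u, y, rfl⟩
  · exact absurd hw.symm hφ
  · have he : (w ++ [x]) ++ h = (v ++ u ++ [y]) ++ h := by simpa [hvu] using hw'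
    have hxy : x = y := by simpa using congrArg List.getLast? (List.append_cancel_right he)
    subst hxy
    refine ⟨D.wit (u.map Prod.snd), D.isWitness_wit _, ?_, v, u, by simp [hvu], rfl⟩
    rw [← hw, List.map_append, List.map_singleton, wit_append_singleton]

/-! ### Matrices of witness sequences -/

variable [Fintype Ω]

/-- The inserted flaw is the earliest in time, so its matrix starts on the far left. The layers
beyond its own are unrelated to it, hence it commutes past them into place. -/
lemma seqMat_ins {D : ResamplingSystem Ω F} (hcomm : D.StronglyCommutative) {f : F}
    {φ : List (Finset F)} (hφ : ∀ S ∈ φ, D.IsIndep S) :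
    D.seqMat (D.ins f φ) = D.transMat f * D.seqMat φ := by
  induction φ with
  | nil => simp [ins, seqMat, layerMat_singleton]
  | cons S φ ih =>
    rw [List.forall_mem_cons] at hφ
    unfold ins
    split_ifs with h
    · rw [seqMat, seqMat, ih hφ.2, Matrix.mul_assoc]
    · have hS : ¬ D.Related f S := fun h' => h (relatedSeq_cons.2 (Or.inl h'))
      have hc := commute_seqMat hcomm (f := f) (φ := φ) fun T hT h' =>
        h ⟨T, List.mem_cons_of_mem _ hT, h'⟩
      rw [seqMat, seqMat, layerMat_insert hcomm (fun h' => hS (.of_mem h'))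
        (isIndep_insert hφ.1 hS), ← Matrix.mul_assoc, ← Matrix.mul_assoc, hc.eq]

lemma layerMat_mul_layerMat {D : ResamplingSystem Ω F} (hcausal : D.IsCausalityGraph)
    (hcomm : D.StronglyCommutative) {S T : Finset F} (hS : D.IsIndep S) (hT : D.IsIndep T)
    {f : F} (hfS : f ∈ S) (hfT : f ∈ T) (hf : ¬ D.adj f f) :
    D.layerMat T * D.layerMat S = 0 := by
  -- In both layers A_f can be moved to either end, which brings the two copies of A_f together.
  have split : ∀ U : Finset F, D.IsIndep U → f ∈ U →
      D.layerMat U = D.transMat f * D.layerMat (U.erase f) ∧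
        Commute (D.transMat f) (D.layerMat (U.erase f)) := by
    intro U hU hfU
    refine ⟨?_, commute_layerMat hcomm ?_⟩
    · conv_lhs => rw [← insert_erase hfU]
      exact layerMat_insert hcomm (notMem_erase _ _) (by rwa [insert_erase hfU])
    · rintro ⟨g, hg, rfl | h⟩
      · exact notMem_erase _ _ hg
      · exact hU g (mem_of_mem_erase hg) f hfU (ne_of_mem_erase hg) h
  obtain ⟨h1, hc⟩ := split T hT hfT
  rw [h1, hc.eq, (split S hS hfS).1, Matrix.mul_assoc,
    ← Matrix.mul_assoc (D.transMat f) (D.transMat f), transMat_mul_self hcausal hf]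
  simp

lemma transMat_mulVec {D : ResamplingSystem Ω F} {f : F} {σ : Ω} (h : σ ∈ D.flaw f)
    (x : Ω → ℝ≥0∞) : (D.transMat f *ᵥ x) σ = ∑ σ', D.ρ f σ σ' * x σ' := by
  simp [Matrix.mulVec, dotProduct, transMat, h]

lemma transMat_mulVec_one_le (D : ResamplingSystem Ω F) (f : F) : D.transMat f *ᵥ 1 ≤ 1 := by
  intro σ
  by_cases h : σ ∈ D.flaw f
  · rw [transMat_mulVec h]
    simp only [Pi.one_apply, mul_one]
    rw [← tsum_fintype (L := .unconditional _), PMF.tsum_coe]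
  · simp [Matrix.mulVec, dotProduct, transMat, h]

lemma mulVec_mono_right (M : Matrix Ω Ω ℝ≥0∞) {x y : Ω → ℝ≥0∞} (h : x ≤ y) :
    M *ᵥ x ≤ M *ᵥ y :=
  fun _ => sum_le_sum fun j _ => mul_le_mul_right (h j) _

/-- A discarded f is unrelated to all of ψ, so A_f commutes past it and acts on the constant vector
1, where it is substochastic. -/
lemma transMat_mulVec_seqMat_le {D : ResamplingSystem Ω F} (hcomm : D.StronglyCommutative)
    {ψ : List (Finset F)} (hψ : D.IsWitness ψ) (f : F) :
    D.transMat f *ᵥ (D.seqMat ψ *ᵥ 1) ≤ D.seqMat (D.push ψ f) *ᵥ 1 := by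
  rw [Matrix.mulVec_mulVec]
  unfold push
  split_ifs with h
  · rw [seqMat_ins hcomm hψ.indep]
  · have hc := commute_seqMat hcomm (f := f) (φ := ψ) fun S hS h' => h (Or.inr ⟨S, hS, h'⟩)
    rw [hc.eq, ← Matrix.mulVec_mulVec]
    exact mulVec_mono_right _ (D.transMat_mulVec_one_le f)

variable [Fintype F]

/-- A flaw of T in Γ⁺(S) but not in Γ(S) lies in S and satisfies f ≁ f, so two adjacent layers
contribute A_f² = 0. -/
lemma seqMat_eq_zero_or_chain {D : ResamplingSystem Ω F} (hcausal : D.IsCausalityGraph)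
    (hcomm : D.StronglyCommutative) {φ : List (Finset F)} (hφ : ∀ S ∈ φ, D.IsIndep S)
    (hc : φ.IsChain fun S T => ∀ f ∈ T, D.Related f S) :
    D.seqMat φ = 0 ∨ φ.IsChain fun S T => T ⊆ D.nbrs S := by
  induction φ with
  | nil => exact Or.inr List.isChain_nil
  | cons S φ ih =>
    rw [List.forall_mem_cons] at hφ
    cases φ with
    | nil => exact Or.inr (List.isChain_singleton _)
    | cons T φ =>
      rw [List.isChain_cons_cons] at hc
      rcases ih hφ.2 hc.2 with h | h
      · left
        rw [seqMat, h, Matrix.zero_mul]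
      · by_cases hTS : T ⊆ D.nbrs S
        · exact Or.inr (List.isChain_cons_cons.2 ⟨hTS, h⟩)
        · left
          obtain ⟨f, hfT, hf⟩ := not_subset.1 hTS
          have hno : ∀ g ∈ S, ¬ D.adj g f := fun g hg h => hf (mem_nbrs.2 ⟨g, hg, h⟩)
          obtain ⟨g, hg, rfl | h'⟩ := hc.1 f hfT
          · rw [seqMat, seqMat, Matrix.mul_assoc, layerMat_mul_layerMat hcausal hcomm hφ.1
              (hφ.2 T List.mem_cons_self) hg hfT (hno f hg), Matrix.mul_zero]
          · exact absurd h' (hno g hg)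

end ResamplingSystem

namespace ResamplingSystem

open Finset Matrix
open scoped Classical

variable {Ω F : Type*} [Fintype F]

/-! ### The process started from a given configuration -/

/-- The distribution of the configuration `n` transitions after `c`. -/
noncomputable def runFrom (D : ResamplingSystem Ω F) (Λ : D.Strategy) :
    ℕ → Config Ω F → PMF (Config Ω F)
  | 0, c => PMF.pure c
  | n + 1, c => (D.step Λ c).bind (runFrom D Λ n)

lemma run_bind_runFrom (D : ResamplingSystem Ω F) (Λ : D.Strategy) (ωinit : PMF Ω) (n m : ℕ) :
    (D.run Λ ωinit n).bind (D.runFrom Λ m) = D.run Λ ωinit (n + m) := by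
  induction m generalizing n with
  | zero => exact PMF.bind_pure _
  | succ m ih =>
    calc (D.run Λ ωinit n).bind (D.runFrom Λ (m + 1))
        = ((D.run Λ ωinit n).bind (D.step Λ)).bind (D.runFrom Λ m) :=
          (PMF.bind_bind _ _ _).symm
      _ = D.run Λ ωinit (n + 1 + m) := ih (n + 1)
      _ = D.run Λ ωinit (n + (m + 1)) := by rw [Nat.add_assoc, Nat.add_comm 1 m]

/-- `run` peels off the last transition, whereas the induction over witnesses has to peel off the
first. -/
lemma run_eq_bind (D : ResamplingSystem Ω F) (Λ : D.Strategy) (ωinit : PMF Ω) (n : ℕ) :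
    D.run Λ ωinit n = ωinit.bind fun σ => D.runFrom Λ n ⟨[], σ, none, 0⟩ := by
  rw [← Nat.zero_add n, ← run_bind_runFrom, Nat.zero_add]
  unfold run
  rw [PMF.bind_map]
  rfl

/-- The configuration after addressing `f` with outcome `σ'`. -/
noncomputable def resampled (c : Config Ω F) (I : Finset F) (f : F) (σ' : Ω) : Config Ω F :=
  ⟨(c.state, f) :: c.hist, σ', some (insert f I), c.rounds⟩

/-- The possible transitions of the algorithm. -/
lemma step_cases (D : ResamplingSystem Ω F) (Λ : D.Strategy) (c : Config Ω F) :
    (c.pc = none ∧ D.present c.state = ∅ ∧ D.step Λ c = PMF.pure c) ∨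
    (c.pc = none ∧ (D.present c.state).Nonempty ∧
      D.step Λ c = PMF.pure ⟨c.hist, c.state, some ∅, c.rounds + 1⟩) ∨
    (∃ I, c.pc = some I ∧ D.available c.state I = ∅ ∧
      D.step Λ c = PMF.pure ⟨c.hist, c.state, none, c.rounds⟩) ∨
    (∃ I, c.pc = some I ∧ ∃ sel : PMF F, (∀ f ∈ sel.support, f ∈ D.available c.state I) ∧
      D.step Λ c = sel.bind fun f => (D.ρ f c.state).map (resampled c I f)) := by
  obtain ⟨h, σ, pc, R⟩ := c
  rcases pc with - | I
  · by_cases hp : D.present σ = ∅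
    · exact Or.inl ⟨rfl, hp, by simp [step, hp]⟩
    · exact Or.inr (Or.inl ⟨rfl, nonempty_iff_ne_empty.2 hp, by simp [step, hp]⟩)
  · by_cases ha : (D.available σ I).Nonempty
    · refine Or.inr (Or.inr (Or.inr ⟨I, rfl, Λ.select h σ I ha, Λ.select_mem h σ I ha, ?_⟩))
      simp only [step, dif_pos ha]
      rfl
    · refine Or.inr (Or.inr (Or.inl ⟨I, rfl, not_nonempty_iff_eq_empty.1 ha, ?_⟩))
      simp only [step, dif_neg ha]

lemma mem_available {D : ResamplingSystem Ω F} {σ : Ω} {I : Finset F} {f : F} :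
    f ∈ D.available σ I ↔ σ ∈ D.flaw f ∧ ¬ D.Related f I := by
  simp [available, present, Related]

lemma mem_present {D : ResamplingSystem Ω F} {σ : Ω} {f : F} :
    f ∈ D.present σ ↔ σ ∈ D.flaw f := by
  simp [present]

lemma suffix_of_mem_support_step {D : ResamplingSystem Ω F} {Λ : D.Strategy} {c c' : Config Ω F}
    (h : c' ∈ (D.step Λ c).support) : c.hist <:+ c'.hist := by
  rcases D.step_cases Λ c with ⟨-, -, hs⟩ | ⟨-, -, hs⟩ | ⟨I, -, -, hs⟩ | ⟨I, -, sel, -, hs⟩ <;>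
    rw [hs] at h
  · rw [PMF.support_pure, Set.mem_singleton_iff] at h
    rw [h]
  · rw [PMF.support_pure, Set.mem_singleton_iff] at h
    rw [h]
  · rw [PMF.support_pure, Set.mem_singleton_iff] at h
    rw [h]
  · obtain ⟨f, -, h⟩ := (PMF.mem_support_bind_iff _ _ _).1 h
    obtain ⟨σ', -, rfl⟩ := (PMF.mem_support_map_iff _ _ _).1 h
    exact List.suffix_cons _ _

lemma suffix_of_mem_support_runFrom {D : ResamplingSystem Ω F} {Λ : D.Strategy} {n : ℕ}
    {c c' : Config Ω F} (h : c' ∈ (D.runFrom Λ n c).support) : c.hist <:+ c'.hist := by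
  induction n generalizing c with
  | zero =>
    rw [runFrom, PMF.support_pure, Set.mem_singleton_iff] at h
    rw [h]
  | succ n ih =>
    obtain ⟨c₁, h1, h2⟩ := (PMF.mem_support_bind_iff _ _ _).1 h
    exact (suffix_of_mem_support_step h1).trans (ih h2)

/-! ### The probability of a witness sequence -/

variable [Fintype Ω]

/-- Induction on the number of transitions, for all φ at once: resampling f first replaces φ by the
unique ψ with `push ψ f = φ`, and averaging over the outcome multiplies by A_f. The selection rule
is irrelevant because the bound holds for every choice of f. -/
lemma runFrom_occurs_le {D : ResamplingSystem Ω F} (hcomm : D.StronglyCommutative)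
    (Λ : D.Strategy) (n : ℕ) (c : Config Ω F) (φ : List (Finset F)) :
    (D.runFrom Λ n c).toOuterMeasure (D.Occurs c.hist φ) ≤ (D.seqMat φ *ᵥ 1) c.state := by
  induction n generalizing c φ with
  | zero =>
    rw [runFrom, PMF.toOuterMeasure_pure_apply]
    split_ifs with h
    · obtain ⟨v, u, hvu, hw⟩ := h
      have hu : u = [] := by
        have := congrArg List.length hvu
        simp only [List.length_append] at this
        exact List.length_eq_zero_iff.1 (by omega)
      rw [← hw, hu]
      simp [wit, seqMat]
    · exact zero_le
  | succ n ih =>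
    by_cases hφ : φ = []
    · subst hφ
      simpa [seqMat] using toOuterMeasure_le_one _ _
    rw [runFrom]
    rcases D.step_cases Λ c with ⟨-, -, hs⟩ | ⟨-, -, hs⟩ | ⟨I, -, -, hs⟩ | ⟨I, -, sel, hsel, hs⟩ <;>
      rw [hs]
    · rw [PMF.pure_bind]
      exact ih c φ
    · rw [PMF.pure_bind]
      exact ih _ φ
    · rw [PMF.pure_bind]
      exact ih _ φ
    · rw [PMF.bind_bind]
      refine toOuterMeasure_bind_le _ _ _ _ fun f hf => ?_
      have hflaw := (mem_available.1 (hsel f hf)).1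
      have hpre : ∀ (c' : Config Ω F) (σ' : Ω),
          c' ∈ (D.runFrom Λ n (resampled c I f σ')).support → c' ∈ D.Occurs c.hist φ →
          ∃ ψ, D.IsWitness ψ ∧ D.push ψ f = φ ∧ c' ∈ D.Occurs ((c.state, f) :: c.hist) ψ :=
        fun c' σ' h1 h2 => Occurs.exists_cons hφ (suffix_of_mem_support_runFrom h1) h2
      rw [PMF.bind_map, PMF.toOuterMeasure_bind_apply, tsum_fintype]
      -- If no ψ exists, the event is impossible after f; otherwise uniqueness of ψ puts it inside a
      -- single event of the induction hypothesis.
      by_cases hex : ∃ ψ, D.IsWitness ψ ∧ D.push ψ f = φ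
      · obtain ⟨ψ, hψ, hpush⟩ := hex
        calc ∑ σ', D.ρ f c.state σ' *
              (D.runFrom Λ n (resampled c I f σ')).toOuterMeasure (D.Occurs c.hist φ)
            ≤ ∑ σ', D.ρ f c.state σ' * (D.seqMat ψ *ᵥ 1) σ' := by
              refine sum_le_sum fun σ' _ => mul_le_mul_right ?_ _
              refine le_trans (PMF.toOuterMeasure_mono _ ?_) (ih (resampled c I f σ') ψ)
              rintro c' ⟨h1, h2⟩
              obtain ⟨ψ', hψ', hpush', ho⟩ := hpre c' σ' h2 h1
              rwa [D.push_injOn f hψ'.nonempty hψ.nonempty (hpush'.trans hpush.symm)] at ho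
          _ = (D.transMat f *ᵥ (D.seqMat ψ *ᵥ 1)) c.state := (transMat_mulVec hflaw _).symm
          _ ≤ (D.seqMat φ *ᵥ 1) c.state := hpush ▸ transMat_mulVec_seqMat_le hcomm hψ f _
      · refine le_trans (le_of_eq (sum_eq_zero fun σ' _ => ?_)) zero_le
        have : (D.runFrom Λ n (resampled c I f σ')).toOuterMeasure (D.Occurs c.hist φ) = 0 := by
          rw [PMF.toOuterMeasure_apply_eq_zero_iff, Set.disjoint_left]
          intro c' h1 h2
          obtain ⟨ψ, hψ, hpush, -⟩ := hpre c' σ' h1 h2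
          exact hex ⟨ψ, hψ, hpush⟩
        simp only [Function.comp_apply, this, mul_zero]

lemma run_occurs_le {D : ResamplingSystem Ω F} (hcomm : D.StronglyCommutative)
    (Λ : D.Strategy) {ω ωinit : PMF Ω} {γ : ℝ≥0∞} (hγ : ∀ σ, ωinit σ ≤ γ * ω σ) (n : ℕ)
    {φ : List (Finset F)} {a : ℝ≥0∞} (hφ : ChargedBy ω (D.seqMat φ) a) :
    (D.run Λ ωinit n).toOuterMeasure (D.Occurs [] φ) ≤ γ * a := by
  rw [run_eq_bind, PMF.toOuterMeasure_bind_apply, tsum_fintype]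
  calc _ ≤ ∑ σ, γ * ω σ * (D.seqMat φ *ᵥ 1) σ :=
        sum_le_sum fun σ _ => mul_le_mul' (hγ σ) (runFrom_occurs_le hcomm Λ n ⟨[], σ, none, 0⟩ φ)
    _ = γ * ∑ σ, ω σ * (D.seqMat φ *ᵥ 1) σ := by simp only [mul_sum, mul_assoc]
    _ ≤ γ * a := mul_le_mul_right hφ.sum_mulVec_one_le _

/-- The probability that the execution has a witness with at least `s ≥ 1` layers. -/
lemma run_exists_long_witness_le {D : ResamplingSystem Ω F} (hcausal : D.IsCausalityGraph)
    (hcomm : D.StronglyCommutative) (Λ : D.Strategy) {ω ωinit : PMF Ω} (hω : ∀ σ, 0 < ω σ)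
    {γ : ℝ≥0∞} (hγ : ∀ σ, ωinit σ ≤ γ * ω σ) {θ : ℝ} (hθ0 : 0 ≤ θ) (hθ1 : θ ≤ 1)
    {lam : F → ℝ} (hlam : D.IsCharge ω lam) {v : Finset F → ℝ} (hv : D.IsSupersolution θ lam v)
    (n : ℕ) {s : ℕ} (hs : 0 < s) :
    (D.run Λ ωinit n).toOuterMeasure
        (⋃ φ : {φ : List (Finset F) // D.IsWitness φ ∧ s ≤ φ.length}, D.Occurs [] φ.1) ≤
      γ * ENNReal.ofReal (θ ^ s * ∑ f, v {f}) := by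
  refine (MeasureTheory.measure_iUnion_le _).trans ?_
  have hle : ∀ φ : {φ : List (Finset F) // D.IsWitness φ ∧ s ≤ φ.length},
      (D.run Λ ωinit n).toOuterMeasure (D.Occurs [] φ.1) ≤
        γ * if φ.1.IsChain (fun S T => T ⊆ D.nbrs S) then ENNReal.ofReal (weight lam φ.1)
          else 0 := by
    intro φ
    refine run_occurs_le hcomm Λ hγ n ?_
    split_ifs with h
    · exact hlam.chargedBy_seqMat hω φ.1
    · rw [(seqMat_eq_zero_or_chain hcausal hcomm φ.2.1.indep φ.2.1.chain).resolve_right h]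
      intro σ'
      simp
  refine (ENNReal.tsum_le_tsum hle).trans ?_
  rw [ENNReal.tsum_mul_left]
  -- It suffices to bound finite subfamilies; their maximal length N makes `stab N` large enough to
  -- contain all stable members.
  refine mul_le_mul_right (ENNReal.summable.tsum_le_of_sum_le fun A => ?_) _
  have hw0 : ∀ φ, 0 ≤ weight lam φ := weight_nonneg hlam.nonneg
  rw [← sum_filter, ← ENNReal.ofReal_sum_of_nonneg fun φ _ => hw0 φ.1]
  refine ENNReal.ofReal_le_ofReal ?_
  have hinj : Set.InjOn (fun φ : {φ : List (Finset F) // D.IsWitness φ ∧ s ≤ φ.length} => φ.1)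
      (A.filter fun φ => φ.1.IsChain (fun S T => T ⊆ D.nbrs S)) :=
    fun _ _ _ _ h => Subtype.ext h
  rw [← sum_image (f := weight lam) hinj]
  set N := A.sup fun φ => φ.1.length with hN
  calc _ ≤ ∑ φ ∈ univ.biUnion fun f : F =>
          (D.stab N {f}).filter fun φ => s ≤ φ.length, weight lam φ := by
        refine sum_le_sum_of_subset_of_nonneg ?_ fun φ _ _ => hw0 φ
        intro χ hχ
        obtain ⟨⟨φ, hφ, hsφ⟩, hA, rfl⟩ := mem_image.1 hχ
        obtain ⟨hA, hc⟩ := mem_filter.1 hA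
        have hlen : φ.length ≤ N := le_sup (f := fun φ : {φ : List (Finset F) //
          D.IsWitness φ ∧ s ≤ φ.length} => φ.1.length) hA
        rcases φ with - | ⟨S, φ⟩
        -- Here s ≥ 1 is essential: the empty witness has weight 1 and no root to sum over.
        · exact absurd hsφ (by simpa using hs.ne')
        · obtain ⟨f, rfl⟩ := hφ.root S (by simp)
          refine mem_biUnion.2 ⟨f, mem_univ f, mem_filter.2 ⟨?_, hsφ⟩⟩
          exact mem_stab hlen hφ.nonempty (List.forall_mem_cons.1 hφ.indep).2 hc
    _ ≤ ∑ f, ∑ φ ∈ (D.stab N {f}).filter fun φ => s ≤ φ.length, weight lam φ :=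
        sum_biUnion_le_sum _ _ _ hw0
    _ ≤ ∑ f, θ ^ s * v {f} := sum_le_sum fun f _ =>
        hv.sum_weight_stab_le hθ0 hθ1 hlam.nonneg N s {f} (D.isIndep_singleton f)
    _ = θ ^ s * ∑ f, v {f} := (mul_sum _ _ _).symm

end ResamplingSystem

namespace ResamplingSystem

open Finset Matrix
open scoped Classical

variable {Ω F : Type*}

/-! ### Chains in the execution history -/

/-- Consecutive flaws `f, g` of the list satisfy `g ∈ Γ⁺(f)`. -/
def IsFlawChain (D : ResamplingSystem Ω F) (l : List F) : Prop :=
  l.IsChain fun a b => a = b ∨ D.adj a b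

/-- The history contains a chain of `k` flaws. -/
def HasChain (D : ResamplingSystem Ω F) (h : List (Ω × F)) (k : ℕ) : Prop :=
  ∃ l, l.Sublist (h.map Prod.snd) ∧ D.IsFlawChain l ∧ l.length = k

/-- The history contains a chain of `k` flaws that can be extended by `f`. -/
def Extends (D : ResamplingSystem Ω F) (h : List (Ω × F)) (f : F) (k : ℕ) : Prop :=
  ∃ l, l.Sublist (h.map Prod.snd) ∧ D.IsFlawChain (f :: l) ∧ l.length = k

/-- The history contains a chain of `k + 1` flaws whose most recent member is `f`. -/
def HasChainAt (D : ResamplingSystem Ω F) (h : List (Ω × F)) (f : F) (k : ℕ) : Prop :=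
  ∃ l, (f :: l).Sublist (h.map Prod.snd) ∧ D.IsFlawChain (f :: l) ∧ l.length = k

lemma HasChain.cons {D : ResamplingSystem Ω F} {h : List (Ω × F)} {k : ℕ}
    (hc : D.HasChain h k) (x : Ω × F) : D.HasChain (x :: h) k := by
  obtain ⟨l, h1, h2⟩ := hc
  exact ⟨l, h1.cons _, h2⟩

lemma Extends.cons {D : ResamplingSystem Ω F} {h : List (Ω × F)} {f : F} {k : ℕ}
    (hc : D.Extends h f k) (x : Ω × F) : D.Extends (x :: h) f k := by
  obtain ⟨l, h1, h2⟩ := hc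
  exact ⟨l, h1.cons _, h2⟩

lemma HasChainAt.cons {D : ResamplingSystem Ω F} {h : List (Ω × F)} {f : F} {k : ℕ}
    (hc : D.HasChainAt h f k) (x : Ω × F) : D.HasChainAt (x :: h) f k := by
  obtain ⟨l, h1, h2⟩ := hc
  exact ⟨l, h1.cons _, h2⟩

lemma Extends.hasChainAt {D : ResamplingSystem Ω F} {h : List (Ω × F)} {f : F} {k : ℕ}
    (hc : D.Extends h f k) (σ : Ω) : D.HasChainAt ((σ, f) :: h) f k := by
  obtain ⟨l, h1, h2⟩ := hc
  exact ⟨l, h1.cons_cons f, h2⟩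

lemma HasChainAt.hasChain {D : ResamplingSystem Ω F} {h : List (Ω × F)} {f : F} {k : ℕ}
    (hc : D.HasChainAt h f k) : D.HasChain h (k + 1) := by
  obtain ⟨l, h1, h2, h3⟩ := hc
  exact ⟨f :: l, h1, h2, by rw [List.length_cons, h3]⟩

lemma HasChainAt.extends {D : ResamplingSystem Ω F} {h : List (Ω × F)} {f g : F} {k : ℕ}
    (hc : D.HasChainAt h f k) (hg : g = f ∨ D.adj f g) : D.Extends h g (k + 1) := by
  obtain ⟨l, h1, h2, h3⟩ := hc
  exact ⟨f :: l, h1, List.isChain_cons_cons.2 ⟨hg.imp id (D.adj_symm _ _), h2⟩,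
    by rw [List.length_cons, h3]⟩

/-! ### Progress of the algorithm, round by round -/

variable [Fintype F]

/-- What is true of every configuration of the algorithm after `n` transitions: completed rounds
give a chain in the history, extended by the flaws of the current round, and unless the algorithm
has stopped, many transitions give many rounds. -/
def Invariant (D : ResamplingSystem Ω F) (n : ℕ) (c : Config Ω F) : Prop :=
  match c.pc with
  | none => D.HasChain c.hist c.rounds ∧
      (∀ f ∈ D.present c.state, D.Extends c.hist f c.rounds) ∧
      (D.present c.state = ∅ ∨ n ≤ c.rounds * (Fintype.card F + 2))
  | some I => ∃ R, c.rounds = R + 1 ∧ D.HasChain c.hist R ∧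
      (∀ f ∈ D.available c.state I, D.Extends c.hist f R) ∧
      (∀ f ∈ I, D.HasChainAt c.hist f R) ∧
      (I = ∅ → (D.present c.state).Nonempty) ∧
      n ≤ R * (Fintype.card F + 2) + 1 + I.card

/-- By causality a flaw that appears after addressing f lies in Γ(f), so the available flaws only
shrink within a round and still extend the old chain. When none is available, every present flaw
lies in Γ⁺(I) and extends a chain ending in I. A round costs one opening test, |I| resamplings and
one closing test, at most |F| + 2 transitions. -/
lemma Invariant.step {D : ResamplingSystem Ω F} (hcausal : D.IsCausalityGraph) {Λ : D.Strategy}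
    {n : ℕ} {c c' : Config Ω F} (hc : D.Invariant n c) (h : c' ∈ (D.step Λ c).support) :
    D.Invariant (n + 1) c' := by
  rcases D.step_cases Λ c with ⟨hpc, hp, hs⟩ | ⟨hpc, hp, hs⟩ | ⟨I, hpc, ha, hs⟩ |
    ⟨I, hpc, sel, hsel, hs⟩ <;> rw [hs] at h <;> unfold Invariant at hc <;> rw [hpc] at hc
  · rw [PMF.support_pure, Set.mem_singleton_iff] at h
    subst h
    unfold Invariant
    rw [hpc]
    exact ⟨hc.1, hc.2.1, Or.inl hp⟩
  · rw [PMF.support_pure, Set.mem_singleton_iff] at h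
    subst h
    refine ⟨c.rounds, rfl, hc.1, fun f hf => hc.2.1 f ?_, by simp, fun _ => hp, ?_⟩
    · exact mem_present.2 (mem_available.1 hf).1
    · have := hc.2.2.resolve_left hp.ne_empty
      simpa using this
  · rw [PMF.support_pure, Set.mem_singleton_iff] at h
    subst h
    obtain ⟨R, hR, -, -, hI, hne, hn⟩ := hc
    -- With I = ∅ every present flaw is available, and a round starts only if some flaw is present;
    -- so a round cannot end empty.
    obtain ⟨g, hg⟩ : I.Nonempty := by
      rw [nonempty_iff_ne_empty]
      rintro rfl
      obtain ⟨f, hf⟩ := hne rfl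
      have : f ∈ D.available c.state ∅ :=
        mem_available.2 ⟨mem_present.1 hf, by simp [Related]⟩
      rw [ha] at this
      exact notMem_empty _ this
    refine ⟨?_, fun f hf => ?_, Or.inr ?_⟩
    · simp only [hR]
      exact (hI g hg).hasChain
    · simp only [hR]
      have hrel : D.Related f I := by
        by_contra hrel
        have := mem_available.2 ⟨mem_present.1 hf, hrel⟩
        rw [ha] at this
        exact notMem_empty _ this
      obtain ⟨g, hg, hfg⟩ := hrel
      exact (hI g hg).extends hfg
    · have := card_le_univ I
      simp only [hR]
      rw [Nat.add_mul]
      omega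
  · obtain ⟨f, hf, h⟩ := (PMF.mem_support_bind_iff _ _ _).1 h
    obtain ⟨σ', hσ', rfl⟩ := (PMF.mem_support_map_iff _ _ _).1 h
    obtain ⟨R, hR, hch, hav, hI, -, hn⟩ := hc
    have hfav := hsel f hf
    obtain ⟨hflaw, hrel⟩ := mem_available.1 hfav
    refine ⟨R, hR, hch.cons _, fun g hg => ?_, fun g hg => ?_, fun he => ?_, ?_⟩
    · obtain ⟨hg1, hg2⟩ := mem_available.1 hg
      refine (hav g (mem_available.2 ⟨?_, ?_⟩)).cons _
      · rcases hcausal _ _ _ ⟨hflaw, hσ'⟩ g hg1 with h | h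
        · exact h.1
        · exact absurd ⟨f, mem_insert_self _ _, Or.inr h⟩ hg2
      · rintro ⟨a, ha, h⟩
        exact hg2 ⟨a, mem_insert_of_mem ha, h⟩
    · rcases mem_insert.1 hg with rfl | hg
      · exact (hav g hfav).hasChainAt _
      · exact (hI g hg).cons _
    · exact absurd he (insert_ne_empty _ _)
    · rw [card_insert_of_notMem fun hfI => hrel (.of_mem hfI)]
      omega

lemma invariant_of_mem_support_run {D : ResamplingSystem Ω F} (hcausal : D.IsCausalityGraph)
    {Λ : D.Strategy} {ωinit : PMF Ω} {n : ℕ} {c : Config Ω F}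
    (h : c ∈ (D.run Λ ωinit n).support) : D.Invariant n c := by
  induction n generalizing c with
  | zero =>
    obtain ⟨σ, -, rfl⟩ := (PMF.mem_support_map_iff _ _ _).1 h
    exact ⟨⟨[], by simp [IsFlawChain]⟩, fun f _ => ⟨[], by simp [IsFlawChain]⟩, Or.inr (by simp)⟩
  | succ n ih =>
    obtain ⟨c₀, h1, h2⟩ := (PMF.mem_support_bind_iff _ _ _).1 h
    exact (ih h1).step hcausal h2

lemma Invariant.halted_or_hasChain {D : ResamplingSystem Ω F} {n s : ℕ} {c : Config Ω F}
    (hn : s * (Fintype.card F + 2) < n) (hc : D.Invariant n c) :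
    (D.Halted c ∧ c.rounds < s) ∨ ∃ k, s ≤ k ∧ D.HasChain c.hist k := by
  unfold Invariant at hc
  split at hc
  · rename_i hpc
    obtain ⟨h1, -, h2⟩ := hc
    by_cases hs : s ≤ c.rounds
    · exact Or.inr ⟨_, hs, h1⟩
    · rcases h2 with h2 | h2
      · exact Or.inl ⟨⟨hpc, h2⟩, not_le.1 hs⟩
      · exact absurd (Nat.lt_of_mul_lt_mul_right (hn.trans_le h2)).le hs
  · obtain ⟨R, -, h1, -, -, -, h2⟩ := hc
    refine Or.inr ⟨R, ?_, h1⟩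
    rename_i I _
    have := card_le_univ I
    -- The unfinished round accounts for at most |F| + 1 transitions, so R completed rounds with R ≥
    -- s are forced.
    have h3 : s * (Fintype.card F + 2) < (R + 1) * (Fintype.card F + 2) := by
      rw [Nat.add_mul]
      omega
    exact Nat.le_of_lt_succ (Nat.lt_of_mul_lt_mul_right h3)

/-- An execution that does not stop within fewer than `s` rounds has a witness with at least `s`
layers. -/
lemma mem_halted_or_occurs {D : ResamplingSystem Ω F} (hcausal : D.IsCausalityGraph)
    {Λ : D.Strategy} {ωinit : PMF Ω} {n s : ℕ} (hn : s * (Fintype.card F + 2) < n)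
    {c : Config Ω F} (h : c ∈ (D.run Λ ωinit n).support) :
    (D.Halted c ∧ c.rounds < s) ∨
      c ∈ ⋃ φ : {φ : List (Finset F) // D.IsWitness φ ∧ s ≤ φ.length}, D.Occurs [] φ.1 := by
  refine ((invariant_of_mem_support_run hcausal h).halted_or_hasChain hn).imp id ?_
  rintro ⟨k, hk, l, hl, hc, rfl⟩
  obtain ⟨v, u, hvu, hu⟩ := D.exists_length_le_wit hl hc
  obtain ⟨v', u', hvu', -, rfl⟩ := List.map_eq_append_iff.1 hvu
  exact Set.mem_iUnion.2 ⟨⟨D.wit (u'.map Prod.snd), D.isWitness_wit _, hk.trans hu⟩,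
    v', u', by rw [List.append_nil, hvu'], rfl⟩

/-! ### From the tail bound to the number of rounds -/

lemma one_le_add_of_support_subset {α : Type*} (p : PMF α) {A B : Set α}
    (h : p.support ⊆ A ∪ B) : 1 ≤ p.toOuterMeasure A + p.toOuterMeasure B := by
  rw [← (PMF.toOuterMeasure_apply_eq_one_iff p (A ∪ B)).2 h]
  exact MeasureTheory.measure_union_le A B

lemma le_gammaInit_mul [Fintype Ω] {ω ωinit : PMF Ω} (hω : ∀ σ, 0 < ω σ) (σ : Ω) :
    ωinit σ ≤ ENNReal.ofReal (gammaInit ωinit ω) * ω σ := by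
  have hpos : 0 < (ω σ).toReal := ENNReal.toReal_pos (hω σ).ne' (ω.apply_ne_top σ)
  have hle : (ωinit σ).toReal / (ω σ).toReal ≤ gammaInit ωinit ω :=
    le_ciSup (f := fun σ => (ωinit σ).toReal / (ω σ).toReal) (Set.finite_range _).bddAbove σ
  rw [← ENNReal.ofReal_toReal (ω.apply_ne_top σ), ← ENNReal.ofReal_toReal (ωinit.apply_ne_top σ),
    ← ENNReal.ofReal_mul ((by positivity : (0 : ℝ) ≤ _).trans hle)]
  exact ENNReal.ofReal_le_ofReal ((div_le_iff₀ hpos).1 hle)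

lemma gammaInit_pos [Fintype Ω] {ω ωinit : PMF Ω} (hω : ∀ σ, 0 < ω σ) :
    0 < gammaInit ωinit ω := by
  obtain ⟨σ, hσ⟩ := ωinit.support_nonempty
  by_contra h
  have := le_gammaInit_mul (ωinit := ωinit) hω σ
  rw [ENNReal.ofReal_of_nonpos (not_lt.1 h), zero_mul] at this
  exact (PMF.mem_support_iff _ _).1 hσ (le_antisymm this zero_le)

/-- `θ ^ T = 1 / (γ M)` for `T = (log γ + log M) / log θ⁻¹`. -/
lemma mul_rpow_log_div_le {θ γ M : ℝ} (hθ : θ ∈ Set.Ioo (0 : ℝ) 1) (hγ : 0 < γ) (hM : 0 ≤ M)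
    (r : ℝ) :
    γ * (θ ^ ((Real.log γ + Real.log M) / Real.log θ⁻¹ + r) * M) ≤ θ ^ r := by
  have hr : 0 ≤ θ ^ r := Real.rpow_nonneg hθ.1.le r
  -- For M = 0 the convention log 0 = 0 breaks the formula for θ^T, but the left side is then zero.
  rcases hM.eq_or_lt with rfl | hM
  · simpa using hr
  have hlog : Real.log θ ≠ 0 := (Real.log_neg hθ.1 hθ.2).ne
  have h : θ ^ ((Real.log γ + Real.log M) / Real.log θ⁻¹) = (γ * M)⁻¹ := by
    rw [Real.rpow_def_of_pos hθ.1, Real.log_inv, ← Real.log_mul hγ.ne' hM.ne',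
      show Real.log θ * (Real.log (γ * M) / -Real.log θ) = -Real.log (γ * M) by field_simp,
      Real.exp_neg, Real.exp_log (mul_pos hγ hM)]
  rw [Real.rpow_add hθ.1, h]
  apply le_of_eq
  field_simp

lemma le_probFinish [Fintype Ω] {D : ResamplingSystem Ω F} (hcausal : D.IsCausalityGraph)
    (hcomm : D.StronglyCommutative) {ω ωinit : PMF Ω} (hω : ∀ σ, 0 < ω σ) {θ : ℝ}
    (hθ : θ ∈ Set.Ioo (0 : ℝ) 1) {lam : F → ℝ} (hlam : D.IsCharge ω lam) {v : Finset F → ℝ}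
    (hv : D.IsSupersolution θ lam v) (Λ : D.Strategy) {r : ℝ}
    (hr : 0 < parallelT ωinit ω θ (fun f => v {f}) + r) :
    ENNReal.ofReal (1 - θ ^ r) ≤
      D.probFinish Λ ωinit (parallelT ωinit ω θ (fun f => v {f}) + r) := by
  set x := parallelT ωinit ω θ (fun f => v {f}) + r with hx
  set s := ⌈x⌉₊ with hs
  -- One transition more than s full rounds can use: by then the run has halted early or shows a
  -- chain of at least s flaws.
  set n := s * (Fintype.card F + 2) + 1 with hn
  set A : Set (Config Ω F) := {c | D.Halted c ∧ (c.rounds : ℝ) < x} with hA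
  set B : Set (Config Ω F) :=
    ⋃ φ : {φ : List (Finset F) // D.IsWitness φ ∧ s ≤ φ.length}, D.Occurs [] φ.1 with hB
  have hsupp : (D.run Λ ωinit n).support ⊆ A ∪ B := by
    intro c hc
    exact (mem_halted_or_occurs hcausal (Nat.lt_succ_self _) hc).imp
      (fun h => ⟨h.1, Nat.lt_ceil.1 h.2⟩) id
  have hone := one_le_add_of_support_subset _ hsupp
  have hγ := gammaInit_pos (ωinit := ωinit) hω
  have hM : 0 ≤ ∑ f, v {f} := sum_nonneg fun f _ => hv.nonneg {f}
  have hBle : (D.run Λ ωinit n).toOuterMeasure B ≤ ENNReal.ofReal (θ ^ r) := by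
    refine (run_exists_long_witness_le hcausal hcomm Λ hω (le_gammaInit_mul hω) hθ.1.le hθ.2.le
      hlam hv n (Nat.ceil_pos.2 hr)).trans ?_
    rw [← ENNReal.ofReal_mul hγ.le]
    refine ENNReal.ofReal_le_ofReal (le_trans ?_ (mul_rpow_log_div_le hθ hγ hM r))
    refine mul_le_mul_of_nonneg_left (mul_le_mul_of_nonneg_right ?_ hM) hγ.le
    rw [← Real.rpow_natCast]
    exact Real.rpow_le_rpow_of_exponent_ge hθ.1 hθ.2.le (Nat.le_ceil x)
  have hAle : (D.run Λ ωinit n).toOuterMeasure A ≤ D.probFinish Λ ωinit x :=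
    le_iSup (fun n => (D.run Λ ωinit n).toOuterMeasure A) n
  rw [ENNReal.ofReal_sub _ (Real.rpow_nonneg hθ.1.le r), ENNReal.ofReal_one, tsub_le_iff_right]
  exact hone.trans (add_le_add hAle hBle)

end ResamplingSystem

theorem theorem2 {Ω F : Type*} [Fintype Ω] [Fintype F] (D : ResamplingSystem Ω F)
    (hcausal : D.IsCausalityGraph) (hcomm : D.StronglyCommutative)
    (ω : PMF Ω) (hω : ∀ σ, 0 < ω σ) (θ : ℝ) (hθ : θ ∈ Set.Ioo (0 : ℝ) 1) (mu : F → ℝ)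
    (hcond : (∃ lam : F → ℝ, D.LLLCondition ω θ lam mu) ∨
      (∃ lam p : F → ℝ, D.ShearerCondition ω θ lam p ∧ ∀ f, mu f = D.q p {f} / D.q p ∅))
    (Λ : D.Strategy) (ωinit : PMF Ω) (r : ℝ) (hr : 0 < parallelT ωinit ω θ mu + r) :
    ENNReal.ofReal (1 - θ ^ r) ≤ D.probFinish Λ ωinit (parallelT ωinit ω θ mu + r) := by
  rcases hcond with ⟨lam, h⟩ | ⟨lam, p, h, hmu⟩
  -- Rewritten as the value on singletons of the supersolution S ↦ ∏ μ.
  · have hv : mu = fun f => ∏ g ∈ {f}, mu g := by simp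
    rw [hv] at hr ⊢
    exact ResamplingSystem.le_probFinish hcausal hcomm hω hθ h.1 h.isSupersolution Λ hr
  · obtain rfl : mu = fun f => D.q p {f} / D.q p ∅ := funext hmu
    exact ResamplingSystem.le_probFinish hcausal hcomm hω hθ h.2.2.1 (h.isSupersolution hθ.1) Λ hr
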